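/- Let $X$ be a topological space with a filtration $\emptyset=X_{-1}\subseteq X_0\subseteq\dots\subseteq X_{n-1}\subsetneq X_n=X$ by closed subsets. Its strata are the non-empty connected components of the sets $X_i\setminus X_{i-1}$; a stratum $S\subseteq X_i\setminus X_{i-1}$ has codimension $\operatorname{codim}S=n-i$ and is singular if $i<n$, that is, if it lies in $\Sigma=X_{n-1}$; points of $X\setminus\Sigma$ are called regular. A perversity is a map $\bar p$ from the set of strata to $\mathbb Z\cup\{\pm\infty\}$ that vanishes on the regular (i.e. non-singular) strata; the top perversity is $\bar t(S)=\operatorname{codim}S-2$ on singular strata. An open subset $U\subseteq X$ carries the induced filtration $U\cap X_i$ and the induced perversity, whose value on a stratum of $U$ is the value of $\bar p$ on the stratum of $X$ containing it. The stratification is locally finite if every point has a neighbourhood that meets only finitely many strata. A singular simplex $\sigma\colon\Delta^\ell\to X$ is $\bar p$-allowable if, for every singular stratum $S$, the set $\sigma^{-1}(S)$ is contained in a compact polyhedron of dimension at most $\ell-\operatorname{codim}S+\bar p(S)$ (with $\dim\emptyset=-\infty$), and $\bar p$-full if $\sigma$ and all its faces are $\bar p$-allowable. The $\bar p$-full simplices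 form a simplicial subset $\mathscr G_{\bar p}X$ of $\operatorname{Sing}X$. For a regular point $x_0$ put $\pi_1^{\bar p}(X,x_0)=\pi_1(\mathscr G_{\bar p}X,x_0)$, and call $X$ $\bar p$-connected if $\mathscr G_{\bar p}X$ has exactly one connected component (when $\bar p\le\bar t$, this means that $X\setminus\Sigma$ is non-empty and path-connected). Theorem (Van Kampen). Suppose that $\bar p\le\bar t$, and let $U_0,U_1$ be open subsets of $X$ with $X=U_0\cup U_1$ such that $U_0$, $U_1$ and $U_0\cap U_1$, with the induced filtrations and perversities, are $\bar p$-connected and have locally finite stratifications. Let $x_0\in U_0\cap U_1$ be a regular point, and let $$j_k\colon\pi_1^{\bar p}(U_0\cap U_1,x_0)\to\pi_1^{\bar p}(U_k,x_0),\qquad \iota_k\colon\pi_1^{\bar p}(U_k,x_0)\to\pi_1^{\bar p}(X,x_0)\qquad(k=0,1)$$ be the homomorphisms induced by the inclusions. Then the homomorphism $$\Phi\colon\pi_1^{\bar p}(U_0,x_0)*\pi_1^{\bar p}(U_1,x_0)\to\pi_1^{\bar p}(X,x_0)$$ extending $\iota_0$ and $\iota_1$ is surjective, and its kernel is the normal subgroup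 generated by the elements $j_0(\omega)\,j_1(\omega)^{-1}$ with $\omega\in\pi_1^{\bar p}(U_0\cap U_1,x_0)$. -/

import Mathlib

universe u

open CategoryTheory Opposite TopologicalSpace

namespace IntersectionHomotopy

/-! ### Filtered spaces, strata, perversities -/

/-- A filtration `X₀ ⊆ X₁ ⊆ ⋯ ⊆ Xₙ = X` of formal dimension `n` by closed subsets
(with the conventions `X₋₁ = ∅`, and `Xᵢ = X` for `i ≥ n`). The requirement `Xₙ₋₁ ≠ X` is the
existence of a regular point; it is not a field, since a regular base point is always given. -/
structure Filtration (X : Type u) [TopologicalSpace X] (n : ℕ) where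
  /-- the skeleta -/
  skel : ℕ → Set X
  isClosed_skel : ∀ i, IsClosed (skel i)
  mono : Monotone skel
  skel_top : skel n = Set.univ

/-- The extended integers `ℤ ∪ {-∞, +∞}`. -/
abbrev ExtInt : Type := WithBot (WithTop ℤ)

/-- The inclusion of the integers in the extended integers. -/
def extInt (k : ℤ) : ExtInt := ((k : WithTop ℤ) : ExtInt)

namespace Filtration

variable {X : Type u} [TopologicalSpace X] {n : ℕ} (F : Filtration X n)

/-- `Xⁱ = Xᵢ \ Xᵢ₋₁`. -/
def piece (i : ℕ) : Set X := {x | x ∈ F.skel i ∧ ∀ j < i, x ∉ F.skel j}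

/-- The singular subspace `Σ = Xₙ₋₁`. -/
def singularSet : Set X := {x | ∃ j < n, x ∈ F.skel j}

/-- A stratum: a connected component of some `Xⁱ`, of formal dimension `i`. -/
@[ext]
structure Stratum where
  /-- the formal dimension -/
  dim : ℕ
  /-- the underlying set -/
  carrier : Set X
  exists_eq : ∃ x ∈ F.piece dim, carrier = connectedComponentIn (F.piece dim) x

namespace Stratum

variable {F}

/-- The formal codimension. -/
def codim (S : F.Stratum) : ℤ := (n : ℤ) - (S.dim : ℤ)

/-- A stratum is regular if it lies in `X \ Σ`, that is, if its formal dimension is `n`. -/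
def IsRegular (S : F.Stratum) : Prop := S.dim = n

/-- A stratum that is not regular. -/
def IsSingular (S : F.Stratum) : Prop := ¬ S.IsRegular

end Stratum

/-- Every point has a neighborhood that meets only finitely many strata. -/
def IsLocallyFinite : Prop :=
  ∀ x : X, ∃ N ∈ nhds x, {S : F.Stratum | (S.carrier ∩ N).Nonempty}.Finite

/-- The induced filtration `Uᵢ = U ∩ Xᵢ` on an open subset. -/
def induced (U : Opens X) : Filtration U n where
  skel i := Subtype.val ⁻¹' F.skel i
  isClosed_skel i := (F.isClosed_skel i).preimage continuous_subtype_val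
  mono _ _ h := Set.preimage_mono (F.mono h)
  skel_top := by rw [F.skel_top, Set.preimage_univ]

variable {F}

/-- The stratum of `X` that contains a given stratum of the open subset `U`
(see `subset_ambient`). -/
noncomputable def Stratum.ambient {U : Opens X} (S : (F.induced U).Stratum) : F.Stratum where
  dim := S.dim
  carrier := connectedComponentIn (F.piece S.dim) (S.exists_eq.choose : X)
  exists_eq := ⟨_, S.exists_eq.choose_spec.1, rfl⟩

theorem Stratum.subset_ambient {U : Opens X} (S : (F.induced U).Stratum) :
    S.carrier ⊆ Subtype.val ⁻¹' S.ambient.carrier := by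
  have h := S.exists_eq.choose_spec
  intro y hy
  rw [h.2] at hy
  have hc : IsPreconnected (Subtype.val ''
      connectedComponentIn ((F.induced U).piece S.dim) S.exists_eq.choose) :=
    isPreconnected_connectedComponentIn.image _ continuous_subtype_val.continuousOn
  refine hc.subset_connectedComponentIn
    (Set.mem_image_of_mem _ (mem_connectedComponentIn h.1)) ?_ (Set.mem_image_of_mem _ hy)
  rintro _ ⟨z, hz, rfl⟩
  exact connectedComponentIn_subset ((F.induced U).piece S.dim) _ hz

theorem Stratum.carrier_subset (S : F.Stratum) : S.carrier ⊆ F.piece S.dim := by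
  obtain ⟨x, -, h⟩ := S.exists_eq
  rw [h]
  exact connectedComponentIn_subset _ _

theorem Stratum.eq_of_mem {S T : F.Stratum} {x : X} (hS : x ∈ S.carrier) (hT : x ∈ T.carrier) :
    S = T := by
  obtain ⟨i, A, a, ha, rfl⟩ := S
  obtain ⟨j, B, b, hb, rfl⟩ := T
  have hi := connectedComponentIn_subset _ _ hS
  have hj := connectedComponentIn_subset _ _ hT
  have hij : i = j := by
    rcases lt_trichotomy i j with h | h | h
    · exact absurd hi.1 (hj.2 _ h)
    · exact h
    · exact absurd hj.1 (hi.2 _ h)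
  subst hij
  have : connectedComponentIn (F.piece i) a = connectedComponentIn (F.piece i) b :=
    (connectedComponentIn_eq hS).trans (connectedComponentIn_eq hT).symm
  simp only [Stratum.mk.injEq, true_and]
  exact this

theorem exists_mem_stratum (x : X) : ∃ S : F.Stratum, x ∈ S.carrier := by
  classical
  have hx : ∃ i, x ∈ F.skel i := ⟨n, by rw [F.skel_top]; trivial⟩
  have hp : x ∈ F.piece (Nat.find hx) :=
    ⟨Nat.find_spec hx, fun j hj => Nat.find_min hx hj⟩
  exact ⟨⟨_, _, x, hp, rfl⟩, mem_connectedComponentIn hp⟩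

theorem Stratum.IsSingular.subset {S : F.Stratum} (hS : S.IsSingular) :
    S.carrier ⊆ F.singularSet := by
  intro x hx
  have h := S.carrier_subset hx
  rcases lt_trichotomy S.dim n with h' | h' | h'
  · exact ⟨_, h', h.1⟩
  · exact absurd h' hS
  · exact absurd (by rw [F.skel_top]; trivial) (h.2 n h')

end Filtration

open Filtration

section

variable {X : Type u} [TopologicalSpace X] {n : ℕ} {F : Filtration X n}

/-- A perversity: a map from the set of strata to `ℤ ∪ {±∞}`, with value `0` on regular strata. -/
structure Perversity (F : Filtration X n) where
  /-- the underlying map -/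
  toFun : F.Stratum → ExtInt
  regular : ∀ S, S.IsRegular → toFun S = 0

open Classical in
/-- The top perversity: `t(S) = codim S - 2` on singular strata. -/
noncomputable def topPerversity (F : Filtration X n) : Perversity F where
  toFun S := if S.IsRegular then 0 else extInt (S.codim - 2)
  regular _ hS := if_pos hS

/-- The pointwise order on perversities. -/
instance : LE (Perversity F) := ⟨fun p q => ∀ S, p.toFun S ≤ q.toFun S⟩

/-- The induced perversity on an open subset: its value on a stratum of `U` is the value on the
stratum of `X` that contains it. -/
noncomputable def Perversity.induced (p : Perversity F) (U : Opens X) :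
    Perversity (F.induced U) where
  toFun S := p.toFun S.ambient
  regular S hS := p.regular S.ambient hS

end

/-! ### Polyhedral dimension -/

section

variable {ι : Type}

/-- A (convex linear) cell: a compact set given by finitely many affine equations and
inequalities. -/
def IsCell (C : Set (ι → ℝ)) : Prop :=
  IsCompact C ∧ ∃ s t : Finset ((ι → ℝ) →ᵃ[ℝ] ℝ),
    C = {x | (∀ f ∈ s, f x = 0) ∧ ∀ g ∈ t, 0 ≤ g x}

/-- `Q` is a compact polyhedron, i.e. a finite union of cells, of dimension at most `d`.
The dimension of a non-empty cell is that of its affine span, and `dim ∅ = -∞`. -/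
def IsPolyhedronOfDimLE (Q : Set (ι → ℝ)) (d : ExtInt) : Prop :=
  ∃ 𝒞 : Set (Set (ι → ℝ)), 𝒞.Finite ∧ Q = ⋃₀ 𝒞 ∧
    ∀ C ∈ 𝒞, IsCell C ∧ (C.Nonempty → extInt (Module.finrank ℝ (vectorSpan ℝ C)) ≤ d)

/-- `A` has polyhedral dimension at most `d`: it is contained in a polyhedron of dimension at
most `d`. -/
def PolyDimLE (A : Set (ι → ℝ)) (d : ExtInt) : Prop :=
  ∃ Q, IsPolyhedronOfDimLE Q d ∧ A ⊆ Q

theorem PolyDimLE.mono {A B : Set (ι → ℝ)} {d : ExtInt} (h : PolyDimLE B d) (hAB : A ⊆ B) :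
    PolyDimLE A d := by
  obtain ⟨Q, hQ, hB⟩ := h
  exact ⟨Q, hQ, hAB.trans hB⟩

theorem PolyDimLE.empty (d : ExtInt) : PolyDimLE (∅ : Set (ι → ℝ)) d :=
  ⟨∅, ⟨∅, Set.finite_empty, by simp, by simp⟩, subset_rfl⟩

theorem PolyDimLE.biUnion {α : Type*} {I : Set α} (hI : I.Finite) {A : α → Set (ι → ℝ)}
    {d : ExtInt} (h : ∀ i ∈ I, PolyDimLE (A i) d) : PolyDimLE (⋃ i ∈ I, A i) d := by
  choose! Q hQ hA using h
  choose! 𝒞 h𝒞 hQ𝒞 hC using hQ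
  refine ⟨⋃₀ ⋃ i ∈ I, 𝒞 i, ⟨_, hI.biUnion h𝒞, rfl, ?_⟩, ?_⟩
  · intro C hC'
    obtain ⟨i, hi, hCi⟩ := Set.mem_iUnion₂.1 hC'
    exact hC i hi C hCi
  · refine Set.iUnion₂_subset fun i hi x hx => ?_
    have hx' := hA i hi hx
    rw [hQ𝒞 i hi] at hx'
    obtain ⟨C, hCi, hxC⟩ := hx'
    exact ⟨C, Set.mem_iUnion₂.2 ⟨i, hi, hCi⟩, hxC⟩

theorem IsPolyhedronOfDimLE.polyDimLE {Q : Set (ι → ℝ)} {d : ExtInt}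
    (h : IsPolyhedronOfDimLE Q d) : PolyDimLE Q d := ⟨Q, h, subset_rfl⟩

theorem isCell_stdSimplex (κ : Type) [Fintype κ] : IsCell (stdSimplex ℝ κ) := by
  classical
  refine ⟨isCompact_stdSimplex ℝ κ,
    {(∑ k, LinearMap.proj (R := ℝ) (φ := fun _ : κ => ℝ) k).toAffineMap -
      AffineMap.const ℝ (κ → ℝ) (1 : ℝ)},
    Finset.univ.image fun k => (LinearMap.proj (R := ℝ) (φ := fun _ : κ => ℝ) k).toAffineMap, ?_⟩
  ext x
  simp [stdSimplex, sub_eq_zero, and_comm]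

/-- The part of the preimage of a cell under a linear map that lies in the standard simplex is a
cell. -/
theorem IsCell.preimage {κ : Type} [Fintype κ] [Finite ι] {C : Set (ι → ℝ)} (hC : IsCell C)
    (L : (κ → ℝ) →ₗ[ℝ] (ι → ℝ)) : IsCell (stdSimplex ℝ κ ∩ L ⁻¹' C) := by
  classical
  obtain ⟨-, s₀, t₀, h₀⟩ := isCell_stdSimplex κ
  obtain ⟨hc, s, t, h⟩ := hC
  refine ⟨(isCompact_stdSimplex ℝ κ).inter_right
      (hc.isClosed.preimage L.continuous_of_finiteDimensional),
    s₀ ∪ s.image fun f => f.comp L.toAffineMap, t₀ ∪ t.image fun f => f.comp L.toAffineMap, ?_⟩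
  rw [h₀, h]
  ext x
  simp only [Set.mem_inter_iff, Set.mem_ofPred_eq, Set.mem_preimage, Finset.mem_union,
    Finset.mem_image]
  constructor
  · rintro ⟨⟨a, b⟩, c, d⟩
    refine ⟨?_, ?_⟩
    · rintro f (hf | ⟨g, hg, rfl⟩)
      · exact a f hf
      · exact c g hg
    · rintro f (hf | ⟨g, hg, rfl⟩)
      · exact b f hf
      · exact d g hg
  · rintro ⟨a, b⟩
    exact ⟨⟨fun f hf => a f (Or.inl hf), fun f hf => b f (Or.inl hf)⟩,
      fun f hf => a _ (Or.inr ⟨f, hf, rfl⟩), fun f hf => b _ (Or.inr ⟨f, hf, rfl⟩)⟩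

theorem finrank_vectorSpan_preimage_le {κ : Type} [Fintype κ] [Finite ι] (C : Set (ι → ℝ))
    (L : (κ → ℝ) →ₗ[ℝ] (ι → ℝ)) :
    Module.finrank ℝ (vectorSpan ℝ (stdSimplex ℝ κ ∩ L ⁻¹' C)) ≤
      Module.finrank ℝ (vectorSpan ℝ C) + Module.finrank ℝ (LinearMap.ker L) := by
  set V := vectorSpan ℝ (stdSimplex ℝ κ ∩ L ⁻¹' C) with hV
  have hmap : V ≤ (vectorSpan ℝ C).comap L := by
    rw [hV, vectorSpan_def, Submodule.span_le]
    rintro _ ⟨x, hx, y, hy, rfl⟩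
    have := vsub_mem_vectorSpan ℝ (s := C) (Set.mem_preimage.1 hx.2) (Set.mem_preimage.1 hy.2)
    simpa using this
  have h1 := LinearMap.finrank_range_add_finrank_ker (L.domRestrict V)
  have h2 : Module.finrank ℝ (LinearMap.range (L.domRestrict V)) ≤
      Module.finrank ℝ (vectorSpan ℝ C) := by
    apply Submodule.finrank_mono
    rintro _ ⟨v, rfl⟩
    exact hmap v.2
  have h3 : Module.finrank ℝ (LinearMap.ker (L.domRestrict V)) ≤
      Module.finrank ℝ (LinearMap.ker L) := by
    rw [← Submodule.finrank_map_subtype_eq V]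
    apply Submodule.finrank_mono
    rintro _ ⟨v, hv, rfl⟩
    exact hv
  omega

theorem extInt_add (a b : ℤ) (c : ExtInt) : extInt (a + b) + c = extInt a + (extInt b + c) := by
  rw [← add_assoc]
  rfl

theorem extInt_le_of_le {a b : ℤ} (h : a ≤ b) : extInt a ≤ extInt b :=
  WithBot.coe_le_coe.2 (WithTop.coe_le_coe.2 h)

theorem PolyDimLE.preimage {κ : Type} [Fintype κ] [Finite ι] {A : Set (ι → ℝ)} {d e : ExtInt}
    (h : PolyDimLE A d) (L : (κ → ℝ) →ₗ[ℝ] (ι → ℝ)) {k : ℕ}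
    (hk : Module.finrank ℝ (LinearMap.ker L) ≤ k) (hd : extInt k + d ≤ e) :
    PolyDimLE (stdSimplex ℝ κ ∩ L ⁻¹' A) e := by
  obtain ⟨_, ⟨𝒞, h𝒞, rfl, hC⟩, hA⟩ := h
  refine (PolyDimLE.biUnion (A := fun C => stdSimplex ℝ κ ∩ L ⁻¹' C) (d := e) h𝒞 ?_).mono ?_
  · intro C hCm
    refine ⟨_, ⟨{stdSimplex ℝ κ ∩ L ⁻¹' C}, Set.finite_singleton _,
      (Set.sUnion_singleton _).symm, ?_⟩, subset_rfl⟩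
    rintro _ rfl
    refine ⟨(hC C hCm).1.preimage L, fun ⟨x, hx⟩ => ?_⟩
    have h1 := (hC C hCm).2 ⟨_, hx.2⟩
    have h2 := finrank_vectorSpan_preimage_le C L
    refine le_trans (extInt_le_of_le (b := (k : ℤ) + Module.finrank ℝ (vectorSpan ℝ C))
      (by omega)) (le_trans ?_ hd)
    exact add_le_add (le_refl (extInt k)) h1
  · rintro x ⟨hx, hxA⟩
    obtain ⟨C, hCm, hxC⟩ := hA hxA
    exact Set.mem_iUnion₂.2 ⟨C, hCm, hx, hxC⟩

end

/-! ### The Gajer space -/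

section

variable {X : Type u} [TopologicalSpace X] {n : ℕ} {F : Filtration X n}

/-- A singular simplex `σ : Δᵏ → X` is `p`-allowable if
`dim σ⁻¹ S ≤ k - codim S + p S` for each singular stratum `S`. -/
def Perversity.Allowable (p : Perversity F) {k : ℕ} (σ : C(stdSimplex ℝ (Fin (k + 1)), X)) :
    Prop :=
  ∀ S : F.Stratum, S.IsSingular →
    PolyDimLE (Subtype.val '' (σ ⁻¹' S.carrier)) (extInt (k - S.codim) + p.toFun S)

/-- A singular simplex is `p`-full if it and all its faces are `p`-allowable. -/
def Perversity.Full (p : Perversity F) {m : SimplexCategoryᵒᵖ}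
    (σ : (TopCat.toSSet.obj (TopCat.of X)).obj m) : Prop :=
  ∀ (k : SimplexCategory) (θ : k ⟶ m.unop), Mono θ →
    p.Allowable (TopCat.toSSetObjEquiv (TopCat.of X) (op k)
      ((TopCat.toSSet.obj (TopCat.of X)).map θ.op σ))

theorem toSSetObjEquiv_map_apply {X : TopCat.{u}} {m k : SimplexCategory} (θ : k ⟶ m)
    (σ : (TopCat.toSSet.obj X).obj (op m)) (z : stdSimplex ℝ (Fin (k.len + 1))) :
    TopCat.toSSetObjEquiv X (op k) ((TopCat.toSSet.obj X).map θ.op σ) z =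
      TopCat.toSSetObjEquiv X (op m) σ (stdSimplex.map θ z) := rfl

theorem finrank_ker_linearMap {k r : ℕ} (f : Fin (k + 1) → Fin (r + 1))
    (hf : Function.Surjective f) :
    Module.finrank ℝ (LinearMap.ker (FunOnFinite.linearMap ℝ ℝ f)) + r = k := by
  have hs : Function.Surjective (FunOnFinite.linearMap ℝ ℝ f) := by
    obtain ⟨g, hg⟩ := hf.hasRightInverse
    intro v
    refine ⟨FunOnFinite.linearMap ℝ ℝ g v, ?_⟩
    rw [← LinearMap.comp_apply, ← FunOnFinite.linearMap_comp]
    have : f ∘ g = id := funext hg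
    rw [this, FunOnFinite.linearMap_id]
    rfl
  have h1 := LinearMap.finrank_range_add_finrank_ker (FunOnFinite.linearMap ℝ ℝ f)
  rw [LinearMap.range_eq_top.2 hs, finrank_top] at h1
  simp at h1
  omega

/-- The pullback of a `p`-allowable simplex along a degeneracy is `p`-allowable. -/
theorem Perversity.Allowable.comp_epi {p : Perversity F} {k r : ℕ}
    {σ : C(stdSimplex ℝ (Fin (r + 1)), X)} (hσ : p.Allowable σ)
    {τ : C(stdSimplex ℝ (Fin (k + 1)), X)} (f : Fin (k + 1) → Fin (r + 1))
    (hf : Function.Surjective f) (hτ : ∀ z, τ z = σ (stdSimplex.map f z)) : p.Allowable τ := by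
  intro S hS
  have hk := finrank_ker_linearMap f hf
  refine ((hσ S hS).preimage (FunOnFinite.linearMap ℝ ℝ f) (k := k - r) (by omega) ?_).mono ?_
  · rw [← extInt_add]
    have : ((k - r : ℕ) : ℤ) + ((r : ℤ) - S.codim) = k - S.codim := by
      rw [Nat.cast_sub (by omega)]
      ring
    rw [this]
  · rintro _ ⟨z, hz, rfl⟩
    refine ⟨z.2, stdSimplex.map f z, ?_, rfl⟩
    have hz' : τ z ∈ S.carrier := hz
    rwa [hτ] at hz'

/-- The Gajer space: the simplicial set of `p`-full singular simplices, as a simplicial subset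
of the singular simplicial set of `X`. -/
def Perversity.gajer (p : Perversity F) : (TopCat.toSSet.obj (TopCat.of X)).Subcomplex where
  obj m := {σ | p.Full σ}
  map {m l} θ σ hσ k φ hφ := by
    have hσ' : p.Full σ := hσ
    let ψ : k ⟶ m.unop := φ ≫ θ.unop
    have h := hσ' _ (Limits.image.ι ψ) inferInstance
    refine h.comp_epi (Limits.factorThruImage ψ)
      (SimplexCategory.epi_iff_surjective.1 inferInstance) ?_
    intro z
    rw [← toSSetObjEquiv_map_apply (Limits.factorThruImage ψ)]
    rw [← Functor.map_comp_apply, ← Functor.map_comp_apply, ← op_comp, Limits.image.fac]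
    rfl

/-- A perverse space is `p`-connected if its Gajer space has exactly one connected component. -/
def Perversity.IsConnected (p : Perversity F) : Prop := (p.gajer : SSet.{u}).IsConnected

/-- A regular point, as a vertex of the Gajer space. -/
noncomputable def Perversity.vertex (p : Perversity F) (x : X) (hx : x ∉ F.singularSet) :
    (p.gajer : SSet.{u}).obj (op (SimplexCategory.mk 0)) :=
  ⟨(TopCat.toSSetObjEquiv (TopCat.of X) (op (SimplexCategory.mk 0))).symm
    (ContinuousMap.const _ x), by
    intro k θ _ S hS
    refine (PolyDimLE.empty _).mono ?_
    rintro _ ⟨z, hz, rfl⟩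
    exact hx (hS.subset hz)⟩

end

/-! ### The fundamental group of a simplicial set -/

section

/-- The fundamental groupoid of a simplicial set: the groupoid generated by the edges, with the
relations `d₂ τ ≫ d₀ τ = d₁ τ` for the `2`-simplices `τ` and `s₀ x = 𝟙` for the vertices `x`. -/
abbrev FundamentalGroupoid (K : SSet.{u}) : Type u :=
  FreeGroupoid ((SSet.truncation 2).obj K).HomotopyCategory

/-- A vertex of a simplicial set, as an object of its fundamental groupoid. -/
def FundamentalGroupoid.of {K : SSet.{u}} (x : K.obj (op (SimplexCategory.mk 0))) :
    FundamentalGroupoid K :=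
  FreeGroupoid.mk (SSet.Truncated.HomotopyCategory.mk
    (V := (SSet.truncation 2).obj K) x)

/-- The functor between fundamental groupoids that a map of simplicial sets induces. -/
noncomputable def FundamentalGroupoid.map {K L : SSet.{u}} (f : K ⟶ L) :
    FundamentalGroupoid K ⥤ FundamentalGroupoid L :=
  FreeGroupoid.map (SSet.Truncated.mapHomotopyCategory ((SSet.truncation 2).map f))

/-- The fundamental group of a simplicial set at a vertex. -/
abbrev Pi1 (K : SSet.{u}) (x : K.obj (op (SimplexCategory.mk 0))) : Type u :=
  FundamentalGroupoid.of x ⟶ FundamentalGroupoid.of x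

/-- The homomorphism between fundamental groups that a pointed map of simplicial sets induces. -/
noncomputable def Pi1.map {K L : SSet.{u}} (f : K ⟶ L) {x : K.obj (op (SimplexCategory.mk 0))}
    {y : L.obj (op (SimplexCategory.mk 0))} (h : f.app _ x = y) : Pi1 K x →* Pi1 L y :=
  (Groupoid.vertexGroupIsomOfMap (eqToHom (congrArg FundamentalGroupoid.of h))).toMonoidHom.comp
    ((FundamentalGroupoid.map f).mapVertexGroup (FundamentalGroupoid.of x))

end

/-! ### Intersection fundamental groups and the maps induced by inclusions -/

section

variable {X : Type u} [TopologicalSpace X] {n : ℕ} {F : Filtration X n}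

/-- The `p`-intersection fundamental group at a regular point `x`. -/
abbrev Perversity.pi1 (p : Perversity F) (x : X) (hx : x ∉ F.singularSet) : Type u :=
  Pi1 p.gajer (p.vertex x hx)

/-- A continuous map that sends each stratum into a stratum with the same formal dimension and
the same perversity. -/
def PreservesStrata {Y : Type u} [TopologicalSpace Y] {G : Filtration Y n} (p : Perversity F)
    (q : Perversity G) (f : C(X, Y)) : Prop :=
  ∀ S : F.Stratum, ∃ T : G.Stratum, S.carrier ⊆ f ⁻¹' T.carrier ∧ T.dim = S.dim ∧
    q.toFun T = p.toFun S

theorem Filtration.IsLocallyFinite.finite_of_isCompact (hF : F.IsLocallyFinite) {K : Set X}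
    (hK : IsCompact K) : {S : F.Stratum | (S.carrier ∩ K).Nonempty}.Finite := by
  choose N hN hfin using hF
  obtain ⟨t, -, ht⟩ := hK.elim_nhds_subcover N (fun x _ => hN x)
  refine (t.finite_toSet.biUnion fun x _ => hfin x).subset ?_
  rintro S ⟨y, hyS, hyK⟩
  obtain ⟨x, hx, hy⟩ := Set.mem_iUnion₂.1 (ht hyK)
  exact Set.mem_iUnion₂.2 ⟨x, hx, y, hyS, hy⟩

theorem Perversity.Allowable.comp {Y : Type u} [TopologicalSpace Y] {G : Filtration Y n}
    {p : Perversity F} {q : Perversity G} {f : C(X, Y)} (hf : PreservesStrata p q f)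
    (hF : F.IsLocallyFinite) {k : ℕ} {σ : C(stdSimplex ℝ (Fin (k + 1)), X)}
    (hσ : p.Allowable σ) : q.Allowable (f.comp σ) := by
  intro T hT
  let I : Set F.Stratum := {S | (S.carrier ∩ Set.range σ).Nonempty ∧ T.dim = S.dim ∧
    q.toFun T = p.toFun S}
  have hI : I.Finite :=
    (hF.finite_of_isCompact (isCompact_range σ.continuous)).subset fun S hS => hS.1
  refine (PolyDimLE.biUnion (A := fun S : F.Stratum => Subtype.val '' (σ ⁻¹' S.carrier)) hI
    ?_).mono ?_
  · rintro S ⟨-, hd, hpq⟩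
    have hS : S.IsSingular := fun h => hT (hd.trans h)
    have := hσ S hS
    rw [Filtration.Stratum.codim, ← hd, ← hpq] at this
    exact this
  · rintro _ ⟨z, hz, rfl⟩
    obtain ⟨S, hS⟩ := F.exists_mem_stratum (σ z)
    obtain ⟨T', hT', hd, hpq⟩ := hf S
    obtain rfl : T' = T := Filtration.Stratum.eq_of_mem (hT' hS) hz
    exact Set.mem_iUnion₂.2 ⟨S, ⟨⟨σ z, hS, z, rfl⟩, hd, hpq⟩, z, hS, rfl⟩

/-- The map between Gajer spaces that is given by composition with `f`. -/
noncomputable def gajerMap {Y : Type u} [TopologicalSpace Y] {G : Filtration Y n}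
    {p : Perversity F} {q : Perversity G} {f : C(X, Y)} (hf : PreservesStrata p q f)
    (hF : F.IsLocallyFinite) : (p.gajer : SSet.{u}) ⟶ (q.gajer : SSet.{u}) :=
  SSet.Subcomplex.lift (p.gajer.ι ≫ TopCat.toSSet.map (TopCat.ofHom f)) (by
    rintro m _ ⟨⟨σ, hσ⟩, rfl⟩ k θ hθ
    exact (hσ k θ hθ).comp hf hF)

/-- The homomorphism between intersection fundamental groups that `f` induces. -/
noncomputable def pi1Map {Y : Type u} [TopologicalSpace Y] {G : Filtration Y n}
    {p : Perversity F} {q : Perversity G} {f : C(X, Y)} (hf : PreservesStrata p q f)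
    (hF : F.IsLocallyFinite) (x : X) (hx : x ∉ F.singularSet) (hy : f x ∉ G.singularSet) :
    p.pi1 x hx →* q.pi1 (f x) hy :=
  Pi1.map (gajerMap hf hF) rfl

theorem preservesStrata_subtype (p : Perversity F) (U : Opens X) :
    PreservesStrata (p.induced U) p ⟨Subtype.val, continuous_subtype_val⟩ :=
  fun S => ⟨S.ambient, S.subset_ambient, rfl, rfl⟩

theorem preservesStrata_inclusion (p : Perversity F) {U V : Opens X} (h : U ≤ V) :
    PreservesStrata (p.induced U) (p.induced V)
      ⟨Set.inclusion h, continuous_inclusion h⟩ := by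
  intro S
  obtain ⟨x, hx, hS⟩ := S.exists_eq
  have hsub : S.carrier ⊆ Set.inclusion h ⁻¹'
      connectedComponentIn ((F.induced V).piece S.dim) (Set.inclusion h x) := by
    intro y hy
    rw [hS] at hy
    have hc : IsPreconnected (Set.inclusion h ''
        connectedComponentIn ((F.induced U).piece S.dim) x) :=
      isPreconnected_connectedComponentIn.image _ (continuous_inclusion h).continuousOn
    refine hc.subset_connectedComponentIn
      (Set.mem_image_of_mem _ (mem_connectedComponentIn hx)) ?_ (Set.mem_image_of_mem _ hy)
    rintro _ ⟨z, hz, rfl⟩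
    exact connectedComponentIn_subset ((F.induced U).piece S.dim) _ hz
  let T : (F.induced V).Stratum := ⟨S.dim, _, Set.inclusion h x, hx, rfl⟩
  refine ⟨T, hsub, rfl, ?_⟩
  have hxS : x ∈ S.carrier := by rw [hS]; exact mem_connectedComponentIn hx
  have : T.ambient = S.ambient :=
    Filtration.Stratum.eq_of_mem (T.subset_ambient (hsub hxS)) (S.subset_ambient hxS)
  exact congrArg p.toFun this

/-- The intersection fundamental group of an open subset `U`, with the induced filtration and the
induced perversity, at a regular point `x` of `X` that lies in `U`. -/
abbrev Perversity.pi1On (p : Perversity F) (U : Opens X) {x : X} (hxU : x ∈ U)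
    (hx : x ∉ F.singularSet) : Type u :=
  (p.induced U).pi1 ⟨x, hxU⟩ hx

/-- The homomorphism induced by the inclusion of an open subset `U` in `X`. -/
noncomputable def Perversity.iota (p : Perversity F) {U : Opens X}
    (hU : (F.induced U).IsLocallyFinite) {x : X} (hxU : x ∈ U) (hx : x ∉ F.singularSet) :
    p.pi1On U hxU hx →* p.pi1 x hx :=
  pi1Map (preservesStrata_subtype p U) hU ⟨x, hxU⟩ hx hx

/-- The homomorphism induced by the inclusion of open subsets `U ⊆ V`. -/
noncomputable def Perversity.incl (p : Perversity F) {U V : Opens X} (h : U ≤ V)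
    (hU : (F.induced U).IsLocallyFinite) {x : X} (hxU : x ∈ U) (hx : x ∉ F.singularSet) :
    p.pi1On U hxU hx →* p.pi1On V (h hxU) hx :=
  pi1Map (preservesStrata_inclusion p h) hU ⟨x, hxU⟩ hx hx

end

end IntersectionHomotopy

namespace IntersectionHomotopy

open Simplicial

/-! ### Group-valued cocycles on a simplicial set -/

namespace FundamentalGroupoid

variable {K L : SSet.{u}} {P : Type u} [Group P]

/-! A functor from the fundamental groupoid of a simplicial set to a group `P` amounts to a cocycle,
a `P`-valued function on edges that is multiplicative on the 2-simplices (`exists_functor`,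
`functor_ext`). The theorem thus reduces to gluing cocycles on the Gajer spaces of the two open sets
that agree on their intersection.

Below the top perversity the simplices that matter are explicit. Allowability bounds the dimension
of the preimage of a singular stratum by `k - 2`, so vertices and edges are regular. With local
finiteness, a 2-simplex is full exactly when its boundary is regular and it meets the singular set
in finitely many points, each subject to a numerical condition on its stratum
(`Perversity.isDisk_eval`, `Perversity.IsDisk.full`).

A compatible family of cocycles is integrated along a regular path: by a Lebesgue number argument it
has a primitive, unique up to a left constant (`exists_isPrimitive`, `IsPrimitive.unique`), and the
increment of the primitive is the glued value. For multiplicativity, a full triangle is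
reparametrized by a square, which is cut along horizontal and vertical lines that miss the finitely
many singular points into rectangles that each lie in one member of the cover. Such a rectangle is
the injective image of a triangle that is again full (`IsMultiplicativeOn.rectangle`), and the small
identities paste (`pathValue_rectangle`). A cocycle is also determined by its restrictions to the
cover (`IsCocycle.eq_of_cover`).

Now let `N` be the normal closure in the statement. Morphisms chosen compatibly from the base point
extend the homomorphisms from the two groups to the quotient by `N` to functors on the groupoids.
These glue to a functor `Ψ`, and `Ψ` after `Φ` is the quotient map, so the kernel of `Φ` lies in
`N`. For surjectivity, `Ψ` followed by the map that `Φ` induces on the quotient agrees over both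
open sets with the functor that closes up morphisms to loops; by uniqueness they coincide, so every
loop is a value of `Φ`. -/

/-- The morphism of the fundamental groupoid given by an edge. -/
def ofEdge {x y : K _⦋0⦌} (e : SSet.Edge x y) : of x ⟶ of y :=
  FreeGroupoid.homMk (SSet.Truncated.HomotopyCategory.homMk e.toTruncated)

theorem ofEdge_comp {x y z : K _⦋0⦌} {e : SSet.Edge x y} {f : SSet.Edge y z} {g : SSet.Edge x z}
    (h : SSet.Edge.CompStruct e f g) : ofEdge e ≫ ofEdge f = ofEdge g := by
  rw [ofEdge, ofEdge, ofEdge, ← SSet.Truncated.HomotopyCategory.homMk_comp_homMk h.toTruncated]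
  exact ((FreeGroupoid.of _).map_comp _ _).symm

theorem map_comp_functor {M : SSet.{u}} (f : K ⟶ L) (g : L ⟶ M) :
    map (f ≫ g) = map f ⋙ map g := by
  rw [map, map, map, ← FreeGroupoid.map_comp]
  exact congrArg FreeGroupoid.map
    (SSet.Truncated.HomotopyCategory.functor_ext (fun _ => rfl) fun _ _ _ =>
      ((Category.id_comp _).trans (Category.comp_id _)).symm)

theorem nonempty_hom [K.IsConnected] (x y : K _⦋0⦌) : Nonempty (of x ⟶ of y) := by
  have h := (SSet.π₀.mk_eq_mk_iff x y).1 (Subsingleton.elim _ _)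
  induction h with
  | rel x y h => exact h.map ofEdge
  | refl x => exact ⟨𝟙 _⟩
  | symm x y _ ih => exact ih.map fun f => Groupoid.inv f
  | trans x y z _ _ ih₁ ih₂ => exact ih₁.map2 (fun f g => f ≫ g) ih₂

/-- The value of a morphism under a functor to a group. -/
def value (V : FundamentalGroupoid K ⥤ SingleObj Pᵐᵒᵖ) {a b : FundamentalGroupoid K}
    (f : a ⟶ b) : P := MulOpposite.unop (V.map f : Pᵐᵒᵖ)

variable (V : FundamentalGroupoid K ⥤ SingleObj Pᵐᵒᵖ)

/-- Composition in `SingleObj G` multiplies in reverse order; the opposite group in the target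
restores the order of concatenation. -/
theorem value_comp {a b c : FundamentalGroupoid K} (f : a ⟶ b) (g : b ⟶ c) :
    value V (f ≫ g) = value V f * value V g :=
  congrArg MulOpposite.unop (V.map_comp f g)

theorem value_id (a : FundamentalGroupoid K) : value V (𝟙 a) = 1 :=
  congrArg MulOpposite.unop (V.map_id a)

theorem value_compStruct {x y z : K _⦋0⦌} {e : SSet.Edge x y} {f : SSet.Edge y z}
    {g : SSet.Edge x z} (h : SSet.Edge.CompStruct e f g) :
    value V (ofEdge e) * value V (ofEdge f) = value V (ofEdge g) := by
  rw [← value_comp, ofEdge_comp h]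

theorem value_congr {x y x' y' : K _⦋0⦌} (e : SSet.Edge x y) (e' : SSet.Edge x' y')
    (h : e.edge = e'.edge) : value V (ofEdge e) = value V (ofEdge e') := by
  obtain rfl : x = x' := by rw [← e.src_eq, ← e'.src_eq, h]
  obtain rfl : y = y' := by rw [← e.tgt_eq, ← e'.tgt_eq, h]
  rw [SSet.Edge.ext h]

end FundamentalGroupoid

/-- A function on the edges of a simplicial set with values in a group that is multiplicative on
the `2`-simplices. -/
def IsCocycle {K : SSet.{u}} {P : Type u} [Group P] (v : K _⦋1⦌ → P) : Prop :=
  ∀ τ : K _⦋2⦌, v (K.δ 2 τ) * v (K.δ 0 τ) = v (K.δ 1 τ)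

namespace FundamentalGroupoid

variable {K L : SSet.{u}} {P : Type u} [Group P]

/-- The cocycle given by a functor from the fundamental groupoid to a group. -/
def cocycle (V : FundamentalGroupoid K ⥤ SingleObj Pᵐᵒᵖ) (e : K _⦋1⦌) : P :=
  value V (ofEdge (SSet.Edge.mk' e))

theorem cocycle_edge (V : FundamentalGroupoid K ⥤ SingleObj Pᵐᵒᵖ) {x y : K _⦋0⦌}
    (e : SSet.Edge x y) : cocycle V e.edge = value V (ofEdge e) :=
  value_congr V _ _ rfl

theorem isCocycle_cocycle (V : FundamentalGroupoid K ⥤ SingleObj Pᵐᵒᵖ) :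
    IsCocycle (cocycle V) := by
  intro τ
  obtain ⟨x, y, z, e, f, g, h, rfl⟩ := SSet.Edge.CompStruct.exists_of_simplex τ
  rw [h.d₂, h.d₀, h.d₁, cocycle_edge, cocycle_edge, cocycle_edge, value_compStruct V h]

theorem exists_functor {v : K _⦋1⦌ → P} (hv : IsCocycle v) :
    ∃ V : FundamentalGroupoid K ⥤ SingleObj Pᵐᵒᵖ, cocycle V = v := by
  have hcomp : ∀ {x y z : K _⦋0⦌} {e : SSet.Edge x y} {f : SSet.Edge y z} {g : SSet.Edge x z}
      (_ : SSet.Edge.CompStruct e f g), v e.edge * v f.edge = v g.edge := by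
    intro x y z e f g h
    rw [← h.d₂, ← h.d₀, ← h.d₁, hv]
  refine ⟨FreeGroupoid.lift (SSet.Truncated.HomotopyCategory.lift
    (V := (SSet.truncation 2).obj K) (D := SingleObj Pᵐᵒᵖ)
    (fun _ => SingleObj.star _) (fun e => MulOpposite.op (v e.edge)) ?_ ?_), ?_⟩
  -- The degenerate 2-simplex on `x` gives `v e * v e = v e` for the degenerate edge, which forces
  -- the value `1`.
  · intro x
    have := hcomp (SSet.Edge.CompStruct.idCompId x)
    exact congrArg MulOpposite.op (mul_eq_left.1 this)
  · intro x y z e f g h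
    exact congrArg MulOpposite.op (hcomp (SSet.Edge.CompStruct.ofTruncated h))
  · funext e
    exact congrArg MulOpposite.unop ((FreeGroupoid.lift_map_homMk _ _).trans
      (SSet.Truncated.HomotopyCategory.lift_map_homMk _ _ _ _ _))

/-- The edges generate the groupoid, and the target has a single object. -/
theorem functor_ext {V W : FundamentalGroupoid K ⥤ SingleObj Pᵐᵒᵖ}
    (h : cocycle V = cocycle W) : V = W := by
  refine FreeGroupoid.functorEquiv.injective
    (SSet.Truncated.HomotopyCategory.functor_ext (fun _ => rfl) ?_)
  intro x y e
  have h' := congrFun h e.edge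
  have h'' := ((cocycle_edge V (SSet.Edge.ofTruncated e)).symm.trans h').trans
    (cocycle_edge W (SSet.Edge.ofTruncated e))
  exact (MulOpposite.unop_injective h'').trans
    ((Category.id_comp _).trans (Category.comp_id _)).symm

end FundamentalGroupoid

end IntersectionHomotopy

namespace IntersectionHomotopy

open Filtration

/-! ### Local finiteness of the stratification passes from an open cover to the space -/

section

variable {X : Type u} [TopologicalSpace X] {n : ℕ} {F : Filtration X n}

theorem isLocallyFinite_of_cover {U₀ U₁ : Opens X} (hcover : U₀ ⊔ U₁ = ⊤)
    (h₀ : (F.induced U₀).IsLocallyFinite) (h₁ : (F.induced U₁).IsLocallyFinite) :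
    F.IsLocallyFinite := by
  have key : ∀ (U : Opens X) (_ : (F.induced U).IsLocallyFinite) (x : X) (_ : x ∈ U),
      ∃ N ∈ nhds x, {S : F.Stratum | (S.carrier ∩ N).Nonempty}.Finite := by
    intro U hU x hx
    obtain ⟨N, hN, hfin⟩ := hU ⟨x, hx⟩
    -- Every stratum of `X` that meets the image of `N` is the ambient stratum of some stratum of
    -- `U` that meets `N`.
    refine ⟨Subtype.val '' N, (U.isOpen.isOpenEmbedding_subtypeVal.image_mem_nhds).2 hN,
      (hfin.image Stratum.ambient).subset ?_⟩
    rintro S ⟨_, hyS, y, hyN, rfl⟩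
    obtain ⟨T, hT⟩ := (F.induced U).exists_mem_stratum y
    exact ⟨T, ⟨y, hT, hyN⟩, Stratum.eq_of_mem (T.subset_ambient hT) hyS⟩
  intro x
  have hx : x ∈ U₀ ⊔ U₁ := by rw [hcover]; trivial
  rcases hx with hx | hx
  · exact key U₀ h₀ x hx
  · exact key U₁ h₁ x hx

end

open Simplicial

/-! ### Zero-dimensional polyhedra -/

section

variable {ι : Type}

theorem isCell_singleton [Fintype ι] (x : ι → ℝ) : IsCell ({x} : Set (ι → ℝ)) := by
  classical
  refine ⟨isCompact_singleton, Finset.univ.image fun i =>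
    (LinearMap.proj (R := ℝ) (φ := fun _ : ι => ℝ) i).toAffineMap -
      AffineMap.const ℝ (ι → ℝ) (x i), ∅, ?_⟩
  ext y
  simp [sub_eq_zero, funext_iff]

theorem polyDimLE_of_finite [Fintype ι] {A : Set (ι → ℝ)} (hA : A.Finite) {d : ExtInt} (hd : extInt 0 ≤ d) :
    PolyDimLE A d := by
  have h : PolyDimLE (⋃ x ∈ A, {x}) d := by
    refine PolyDimLE.biUnion hA fun x _ => ⟨{x}, ⟨{{x}}, Set.finite_singleton _, by simp, ?_⟩,
      subset_rfl⟩
    rintro _ rfl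
    refine ⟨isCell_singleton x, fun _ => ?_⟩
    rwa [vectorSpan_singleton, finrank_bot]
  simpa using h

/-- A nonempty cell of dimension at most `0` has trivial direction space, so it is a single point; a
polyhedron has finitely many cells. -/
theorem PolyDimLE.finite [Fintype ι] {A : Set (ι → ℝ)} {d : ExtInt} (h : PolyDimLE A d) (hd : d ≤ extInt 0) :
    A.Finite := by
  obtain ⟨_, ⟨𝒞, h𝒞, rfl, hC⟩, hA⟩ := h
  refine (h𝒞.sUnion fun C hCm => ?_).subset hA
  refine Set.Subsingleton.finite fun x hx y hy => ?_
  have h1 := ((hC C hCm).2 ⟨x, hx⟩).trans hd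
  have h2 : Module.finrank ℝ (vectorSpan ℝ C) = 0 := by
    have := WithTop.coe_le_coe.1 (WithBot.coe_le_coe.1 h1)
    omega
  have h3 := vsub_mem_vectorSpan ℝ hx hy
  rw [Submodule.finrank_eq_zero.1 h2, Submodule.mem_bot] at h3
  exact vsub_eq_zero_iff_eq.1 h3

theorem PolyDimLE.zero_le {A : Set (ι → ℝ)} {d : ExtInt} (h : PolyDimLE A d) (hA : A.Nonempty) :
    extInt 0 ≤ d := by
  obtain ⟨_, ⟨𝒞, h𝒞, rfl, hC⟩, hAQ⟩ := h
  obtain ⟨x, hx⟩ := hA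
  obtain ⟨C, hCm, hxC⟩ := hAQ hx
  exact (extInt_le_of_le (by positivity)).trans ((hC C hCm).2 ⟨x, hxC⟩)

end

/-! ### Simplices of the Gajer space in low dimensions -/

section

variable {X : Type u} [TopologicalSpace X] {n : ℕ} {F : Filtration X n} {p : Perversity F}

theorem not_mem_singularSet_of_forall {x : X}
    (h : ∀ S : F.Stratum, S.IsSingular → x ∉ S.carrier) : x ∉ F.singularSet := by
  rintro ⟨j, hj, hx⟩
  obtain ⟨S, hS⟩ := F.exists_mem_stratum x
  refine h S (fun h' => ?_) hS
  exact (S.carrier_subset hS).2 j (by rw [h']; exact hj) hx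

theorem exists_stratum_of_mem_singularSet {x : X} (hx : x ∈ F.singularSet) :
    ∃ S : F.Stratum, S.IsSingular ∧ x ∈ S.carrier := by
  by_contra! h
  exact not_mem_singularSet_of_forall h hx

/-- The codimension cancels. The bound is negative for `k ≤ 1` and zero for `k = 2`, which makes
edges regular and singular points on full triangles isolated. -/
theorem add_le_of_le_topPerversity (hp : p ≤ topPerversity F) {S : F.Stratum} (hS : S.IsSingular)
    (k : ℤ) : extInt (k - S.codim) + p.toFun S ≤ extInt (k - 2) := by
  have h := hp S
  have ht : (topPerversity F).toFun S = extInt (S.codim - 2) := if_neg hS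
  rw [ht] at h
  refine (add_le_add le_rfl h).trans (le_of_eq ?_)
  have : k - 2 = (k - S.codim) + (S.codim - 2) := by ring
  rw [this]
  rfl

/-- The map underlying a simplex of the Gajer space. -/
noncomputable def Perversity.eval {k : ℕ} (σ : (p.gajer : SSet.{u}) _⦋k⦌) :
    C(stdSimplex ℝ (Fin (k + 1)), X) :=
  TopCat.toSSetObjEquiv (TopCat.of X) (op ⦋k⦌) σ.1

theorem Perversity.eval_injective {k : ℕ} :
    Function.Injective (Perversity.eval (p := p) (k := k)) :=
  fun _ _ h => Subtype.ext ((TopCat.toSSetObjEquiv _ _).injective h)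

theorem Perversity.eval_δ {k : ℕ} (σ : (p.gajer : SSet.{u}) _⦋k + 1⦌) (i : Fin (k + 2))
    (z : stdSimplex ℝ (Fin (k + 1))) :
    Perversity.eval ((p.gajer : SSet.{u}).δ i σ) z =
      Perversity.eval σ (stdSimplex.map (i.succAbove) z) := rfl

/-- A singular simplex in the regular part, as a simplex of the Gajer space. -/
noncomputable def Perversity.mkRegular (p : Perversity F) {k : ℕ}
    (α : C(stdSimplex ℝ (Fin (k + 1)), X)) (hα : ∀ z, α z ∉ F.singularSet) :
    (p.gajer : SSet.{u}) _⦋k⦌ :=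
  ⟨(TopCat.toSSetObjEquiv (TopCat.of X) (op ⦋k⦌)).symm α, by
    intro k θ _ S hS
    refine (PolyDimLE.empty _).mono ?_
    rintro _ ⟨z, hz, rfl⟩
    exact hα _ (hS.subset hz)⟩

/-- The points that may lie in the image of a full `2`-simplex. -/
def Perversity.Admissible (p : Perversity F) (x : X) : Prop :=
  ∀ S : F.Stratum, S.IsSingular → x ∈ S.carrier → extInt 0 ≤ extInt (2 - S.codim) + p.toFun S

theorem Perversity.Admissible.induced {U : Opens X} {x : U} (h : p.Admissible x) :
    (p.induced U).Admissible x :=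
  fun S hS hx => h S.ambient hS (S.subset_ambient hx)

/-- The characterization of full `2`-simplices for perversities below the top perversity. -/
structure Perversity.IsDisk (p : Perversity F) (β : C(stdSimplex ℝ (Fin 3), X)) : Prop where
  boundary : ∀ z i, z i = 0 → β z ∉ F.singularSet
  finite : {z | β z ∈ F.singularSet}.Finite
  admissible : ∀ z, p.Admissible (β z)

theorem stdSimplex_map_apply_eq_zero {k l : ℕ} (f : Fin k → Fin l) (z : stdSimplex ℝ (Fin k))
    {i : Fin l} (hi : i ∉ Set.range f) : stdSimplex.map f z i = 0 := by
  rw [stdSimplex.map_coe, FunOnFinite.linearMap_apply_apply]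
  refine Finset.sum_eq_zero fun j hj => ?_
  exact absurd ⟨j, (Finset.mem_filter.1 hj).2⟩ hi

theorem stdSimplex_map_injective {k l : ℕ} {f : Fin k → Fin l} (hf : Function.Injective f) :
    Function.Injective (stdSimplex.map (S := ℝ) f) := by
  intro z w h
  ext i
  have h' := congrArg (fun a : stdSimplex ℝ (Fin l) => a (f i)) h
  simp only [stdSimplex.map_coe, FunOnFinite.linearMap_apply_apply] at h'
  have : (Finset.univ.filter fun j => f j = f i) = {i} := by
    ext j
    simp [hf.eq_iff]
  simpa [this] using h'

/-- A face is either the whole triangle up to an injective reparametrization, where finiteness and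
admissibility apply, or lies in the boundary, where the singular set is not met at all. -/
theorem Perversity.IsDisk.full {β : C(stdSimplex ℝ (Fin 3), X)} (hβ : p.IsDisk β) :
    p.Full ((TopCat.toSSetObjEquiv (TopCat.of X) (op ⦋2⦌)).symm β) := by
  intro k θ hθ S hS
  have hinj : Function.Injective θ := SimplexCategory.mono_iff_injective.1 hθ
  by_cases hsurj : Function.Surjective θ
  · have hk : k.len = 2 := by
      have := Fintype.card_of_bijective ⟨hinj, hsurj⟩
      simp at this
      omega
    -- The bound may be negative for a stratum that is not met; only a point of the preimage
    -- supplies the inequality that admissibility asserts.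
    obtain he | ⟨_, z, hz, -⟩ := Set.eq_empty_or_nonempty
      (Subtype.val '' ((TopCat.toSSetObjEquiv (TopCat.of X) (op k)
        ((TopCat.toSSet.obj (TopCat.of X)).map θ.op
          ((TopCat.toSSetObjEquiv (TopCat.of X) (op ⦋2⦌)).symm β))) ⁻¹' S.carrier))
    · rw [he]
      exact PolyDimLE.empty _
    · refine polyDimLE_of_finite (Set.Finite.image _ ?_) ?_
      · refine (hβ.finite.preimage (f := stdSimplex.map θ)
          (stdSimplex_map_injective hinj).injOn).subset ?_
        intro w hw
        exact hS.subset hw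
      · rw [hk]
        exact hβ.admissible _ S hS hz
  · refine (PolyDimLE.empty _).mono ?_
    rintro _ ⟨z, hz, rfl⟩
    obtain ⟨i, hi⟩ := not_forall.1 hsurj
    exact hβ.boundary (stdSimplex.map θ z) i (stdSimplex_map_apply_eq_zero _ _ hi) (hS.subset hz)

/-- A `2`-simplex of the Gajer space. -/
noncomputable def Perversity.mkDisk (p : Perversity F) (β : C(stdSimplex ℝ (Fin 3), X))
    (hβ : p.IsDisk β) : (p.gajer : SSet.{u}) _⦋2⦌ := ⟨_, hβ.full⟩

theorem Perversity.allowable_eval {k : ℕ} (σ : (p.gajer : SSet.{u}) _⦋k⦌) :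
    p.Allowable (Perversity.eval σ) := by
  have h := σ.2 _ (𝟙 _) inferInstance
  rw [op_id, CategoryTheory.Functor.map_id_apply] at h
  exact h

theorem Perversity.eval_regular_of_le_one (hp : p ≤ topPerversity F) {k : ℕ} (hk : k ≤ 1)
    (σ : (p.gajer : SSet.{u}) _⦋k⦌) (z) : Perversity.eval σ z ∉ F.singularSet := by
  refine not_mem_singularSet_of_forall fun S hS hz => ?_
  have h := (Perversity.allowable_eval σ S hS).zero_le ⟨_, z, hz, rfl⟩
  have h' := WithTop.coe_le_coe.1 (WithBot.coe_le_coe.1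
    (h.trans (add_le_of_le_topPerversity hp hS k)))
  omega

theorem exists_map_succAbove {k : ℕ} (z : stdSimplex ℝ (Fin (k + 2))) (i : Fin (k + 2))
    (hz : z i = 0) : ∃ w : stdSimplex ℝ (Fin (k + 1)), stdSimplex.map i.succAbove w = z := by
  have hs := z.2.2
  rw [Fin.sum_univ_succAbove _ i] at hs
  have hz' : z.1 i = 0 := hz
  rw [hz', zero_add] at hs
  refine ⟨⟨fun j => z.1 (i.succAbove j), fun j => z.2.1 _, hs⟩, ?_⟩
  ext j
  rw [stdSimplex.map_coe, FunOnFinite.linearMap_apply_apply]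
  refine Fin.succAboveCases i ?_ (fun j => ?_) j
  · rw [hz]
    refine Finset.sum_eq_zero fun j hj => ?_
    exact absurd (Finset.mem_filter.1 hj).2 (Fin.succAbove_ne _ _)
  · have : (Finset.univ.filter fun l => i.succAbove l = i.succAbove j) = {j} := by
      ext l
      simp
    rw [this, Finset.sum_singleton]
    rfl

/-- The boundary consists of edges, which are regular. The preimage of each singular stratum is
finite, and by local finiteness the compact image meets only finitely many strata. -/
theorem Perversity.isDisk_eval (hp : p ≤ topPerversity F) (hF : F.IsLocallyFinite)
    (τ : (p.gajer : SSet.{u}) _⦋2⦌) : p.IsDisk (Perversity.eval τ) where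
  boundary z i hz := by
    obtain ⟨w, rfl⟩ := exists_map_succAbove z i hz
    rw [← Perversity.eval_δ]
    exact Perversity.eval_regular_of_le_one hp le_rfl _ w
  finite := by
    have hI := hF.finite_of_isCompact (isCompact_range (Perversity.eval τ).continuous)
    refine Set.Finite.of_finite_image (f := Subtype.val) ?_ Subtype.val_injective.injOn
    refine ((hI.inter_of_left {S | S.IsSingular}).biUnion fun S hS =>
      (Perversity.allowable_eval τ S hS.2).finite ?_).subset ?_
    · exact add_le_of_le_topPerversity hp hS.2 2
    · rintro _ ⟨z, hz, rfl⟩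
      obtain ⟨S, hS, hzS⟩ := exists_stratum_of_mem_singularSet hz
      exact Set.mem_iUnion₂.2 ⟨S, ⟨⟨_, hzS, z, rfl⟩, hS⟩, z, hzS, rfl⟩
  admissible z S hS hz := (Perversity.allowable_eval τ S hS).zero_le ⟨_, z, hz, rfl⟩

end

end IntersectionHomotopy

namespace IntersectionHomotopy

open Filtration

/-! ### Multiplicative functions on singular edges -/

section

variable {X : Type u} [TopologicalSpace X] {n : ℕ} {F : Filtration X n} {P : Type u} [Group P]

/-- A face of a singular triangle. -/
noncomputable def face (β : C(stdSimplex ℝ (Fin 3), X)) (i : Fin 3) :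
    C(stdSimplex ℝ (Fin 2), X) :=
  β.comp ⟨stdSimplex.map i.succAbove, stdSimplex.continuous_map _⟩

theorem face_apply (β : C(stdSimplex ℝ (Fin 3), X)) (i : Fin 3) (z : stdSimplex ℝ (Fin 2)) :
    face β i z = β (stdSimplex.map i.succAbove z) := rfl

/-- A function on singular edges that is multiplicative on the `2`-simplices of the Gajer space
that lie in `V`. -/
def IsMultiplicativeOn (p : Perversity F) (V : Set X) (w : C(stdSimplex ℝ (Fin 2), X) → P) :
    Prop :=
  ∀ β : C(stdSimplex ℝ (Fin 3), X), (∀ z, β z ∈ V) → p.IsDisk β →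
    w (face β 2) * w (face β 0) = w (face β 1)

/-- The segment between two parameters of a path. -/
noncomputable def seg (γ : C(ℝ, X)) (s t : ℝ) : C(stdSimplex ℝ (Fin 2), X) :=
  ⟨fun z => γ (z 0 * s + z 1 * t), by
    have h : ∀ i : Fin 2, Continuous fun z : stdSimplex ℝ (Fin 2) => z i :=
      fun i => (continuous_apply i).comp continuous_subtype_val
    exact γ.continuous.comp (((h 0).mul_const s).add ((h 1).mul_const t))⟩

theorem seg_apply (γ : C(ℝ, X)) (s t : ℝ) (z : stdSimplex ℝ (Fin 2)) :
    seg γ s t z = γ (z 0 * s + z 1 * t) := rfl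

theorem continuous_coord {k : ℕ} (i : Fin k) : Continuous fun z : stdSimplex ℝ (Fin k) => z i :=
  (continuous_apply i).comp continuous_subtype_val

theorem combination_mem_Icc {s t : ℝ} (hst : s ≤ t) (z : stdSimplex ℝ (Fin 2)) :
    z 0 * s + z 1 * t ∈ Set.Icc s t := by
  have h0 := stdSimplex.zero_le z 0
  have h1 := stdSimplex.zero_le z 1
  have h := stdSimplex.add_eq_one z
  have h0' : z 0 = 1 - z 1 := by linarith
  rw [h0'] at h0 ⊢
  constructor <;> nlinarith

theorem seg_congr {γ γ' : C(ℝ, X)} {s t s' t' : ℝ}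
    (h : ∀ r ∈ Set.Icc (0 : ℝ) 1, γ (s + r * (t - s)) = γ' (s' + r * (t' - s'))) :
    seg γ s t = seg γ' s' t' := by
  ext z
  have h1 := stdSimplex.zero_le z 1
  have h1' := stdSimplex.le_one z 1
  have h2 := stdSimplex.add_eq_one z
  have h0 : z 0 = 1 - z 1 := by linarith
  have := h (z 1) ⟨h1, h1'⟩
  rw [seg_apply, seg_apply, h0]
  convert this using 2 <;> ring

theorem face_coords_zero (z : stdSimplex ℝ (Fin 2)) :
    stdSimplex.map (Fin.succAbove (0 : Fin 3)) z 0 = 0 ∧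
    stdSimplex.map (Fin.succAbove (0 : Fin 3)) z 1 = z 0 ∧
    stdSimplex.map (Fin.succAbove (0 : Fin 3)) z 2 = z 1 := by
  simp [stdSimplex.map_coe, FunOnFinite.linearMap_apply_apply, Finset.sum_filter]

theorem face_coords_one (z : stdSimplex ℝ (Fin 2)) :
    stdSimplex.map (Fin.succAbove (1 : Fin 3)) z 0 = z 0 ∧
    stdSimplex.map (Fin.succAbove (1 : Fin 3)) z 1 = 0 ∧
    stdSimplex.map (Fin.succAbove (1 : Fin 3)) z 2 = z 1 := by
  have h0 : Fin.succAbove (1 : Fin 3) 0 = 0 := rfl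
  have h1 : Fin.succAbove (1 : Fin 3) 1 = 2 := rfl
  simp [stdSimplex.map_coe, FunOnFinite.linearMap_apply_apply, Finset.sum_filter, h0, h1]

theorem face_coords_two (z : stdSimplex ℝ (Fin 2)) :
    stdSimplex.map (Fin.succAbove (2 : Fin 3)) z 0 = z 0 ∧
    stdSimplex.map (Fin.succAbove (2 : Fin 3)) z 1 = z 1 ∧
    stdSimplex.map (Fin.succAbove (2 : Fin 3)) z 2 = 0 := by
  have h0 : Fin.succAbove (2 : Fin 3) 0 = 0 := rfl
  have h1 : Fin.succAbove (2 : Fin 3) 1 = 1 := rfl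
  simp [stdSimplex.map_coe, FunOnFinite.linearMap_apply_apply, Finset.sum_filter, h0, h1]

theorem isDisk_of_regular (p : Perversity F) {β : C(stdSimplex ℝ (Fin 3), X)}
    (hβ : ∀ z, β z ∉ F.singularSet) : p.IsDisk β where
  boundary z _ _ := hβ z
  finite := by
    convert Set.finite_empty
    exact Set.eq_empty_of_forall_notMem hβ
  admissible z _ hS hz := absurd (hS.subset hz) (hβ z)

namespace IsMultiplicativeOn

variable {p : Perversity F} {V : Set X} {w : C(stdSimplex ℝ (Fin 2), X) → P}

/-- The triangle that maps affinely to the interval with vertices sent to `s`, `t`, `u`, followed by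
`γ`, is regular and has the three segments as its faces. -/
theorem seg_mul_seg (hw : IsMultiplicativeOn p V w) {γ : C(ℝ, X)} {s t u : ℝ} (hst : s ≤ t)
    (htu : t ≤ u) (hV : ∀ r ∈ Set.Icc s u, γ r ∈ V)
    (hreg : ∀ r ∈ Set.Icc s u, γ r ∉ F.singularSet) :
    w (seg γ s t) * w (seg γ t u) = w (seg γ s u) := by
  let β : C(stdSimplex ℝ (Fin 3), X) :=
    ⟨fun z => γ (z 0 * s + z 1 * t + z 2 * u), γ.continuous.comp
      ((((continuous_coord 0).mul_const s).add ((continuous_coord 1).mul_const t)).add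
        ((continuous_coord 2).mul_const u))⟩
  have hmem : ∀ z : stdSimplex ℝ (Fin 3), z 0 * s + z 1 * t + z 2 * u ∈ Set.Icc s u := by
    intro z
    have h0 := stdSimplex.zero_le z 0
    have h1 := stdSimplex.zero_le z 1
    have h2 := stdSimplex.zero_le z 2
    have h : z 0 + z 1 + z 2 = 1 := by
      rw [← Fin.sum_univ_three (fun i => z i)]; exact stdSimplex.sum_eq_one z
    have h0' : z 0 = 1 - z 1 - z 2 := by linarith
    rw [h0'] at h0 ⊢
    constructor <;> nlinarith
  have h := hw β (fun z => hV _ (hmem z)) (isDisk_of_regular p fun z => hreg _ (hmem z))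
  have e2 : face β 2 = seg γ s t := by
    ext z
    obtain ⟨a, b, c⟩ := face_coords_two z
    rw [face_apply]
    change γ _ = γ _
    rw [a, b, c, zero_mul, add_zero]
  have e0 : face β 0 = seg γ t u := by
    ext z
    obtain ⟨a, b, c⟩ := face_coords_zero z
    rw [face_apply]
    change γ _ = γ _
    rw [a, b, c, zero_mul, zero_add]
  have e1 : face β 1 = seg γ s u := by
    ext z
    obtain ⟨a, b, c⟩ := face_coords_one z
    rw [face_apply]
    change γ _ = γ _
    rw [a, b, c, zero_mul, add_zero]
  rwa [e2, e0, e1] at h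

theorem seg_self (hw : IsMultiplicativeOn p V w) {γ : C(ℝ, X)} {s : ℝ} (hV : γ s ∈ V)
    (hreg : γ s ∉ F.singularSet) : w (seg γ s s) = 1 := by
  have h := hw.seg_mul_seg (γ := γ) (le_refl s) (le_refl s) (by simpa using hV)
    (by simpa using hreg)
  exact mul_eq_left.1 h

end IsMultiplicativeOn

/-- The restriction of a map on the plane to a horizontal line. -/
def row (H : C(ℝ × ℝ, X)) (c : ℝ) : C(ℝ, X) :=
  ⟨fun x => H (x, c), H.continuous.comp (by fun_prop)⟩

/-- The restriction of a map on the plane to a vertical line. -/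
def column (H : C(ℝ × ℝ, X)) (a : ℝ) : C(ℝ, X) :=
  ⟨fun y => H (a, y), H.continuous.comp (by fun_prop)⟩

/-- A map on the plane that is regular on the boundary of a rectangle, and meets the singular set
in the rectangle finitely often, at admissible points. -/
structure IsDiskOn (p : Perversity F) (H : C(ℝ × ℝ, X)) (a b c d : ℝ) : Prop where
  left : ∀ y ∈ Set.Icc c d, H (a, y) ∉ F.singularSet
  right : ∀ y ∈ Set.Icc c d, H (b, y) ∉ F.singularSet
  bottom : ∀ x ∈ Set.Icc a b, H (x, c) ∉ F.singularSet
  top : ∀ x ∈ Set.Icc a b, H (x, d) ∉ F.singularSet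
  finite : {q : ℝ × ℝ | q ∈ Set.Icc a b ×ˢ Set.Icc c d ∧ H q ∈ F.singularSet}.Finite
  admissible : ∀ q ∈ Set.Icc a b ×ˢ Set.Icc c d, p.Admissible (H q)

namespace IsMultiplicativeOn

variable {p : Perversity F} {V : Set X} {w : C(stdSimplex ℝ (Fin 2), X) → P}

/-- The rectangle is parametrized by a triangle with a right angle at `(b, c)`, whose hypotenuse is
bent to the left and the top side. -/
theorem rectangle (hw : IsMultiplicativeOn p V w) {H : C(ℝ × ℝ, X)} {a b c d : ℝ} (hab : a < b)
    (hcd : c < d) (hV : ∀ q ∈ Set.Icc a b ×ˢ Set.Icc c d, H q ∈ V) (hH : IsDiskOn p H a b c d) :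
    w (seg (row H c) a b) * w (seg (column H b) c d) =
      w (seg (column H a) c d) * w (seg (row H d) a b) := by
  -- In terms of the barycentric coordinates `u`, `v` of vertices `0` and `2`, the vertices go to
  -- `(a, c)`, `(b, c)`, `(b, d)`. The summand `min u v` pushes the midpoint of the hypotenuse to
  -- the corner `(a, d)`.
  let φ : ℝ → ℝ → ℝ × ℝ := fun u v =>
    (b - (u + min u v) * (b - a), c + (v + min u v) * (d - c))
  have hφ : Continuous fun q : ℝ × ℝ => φ q.1 q.2 := by
    simp only [φ]
    fun_prop
  have hφmem : ∀ u v, 0 ≤ u → 0 ≤ v → u + v ≤ 1 → φ u v ∈ Set.Icc a b ×ˢ Set.Icc c d := by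
    intro u v hu hv huv
    have h1 : 0 ≤ min u v := le_min hu hv
    have h2 : min u v ≤ u := min_le_left _ _
    have h3 : min u v ≤ v := min_le_right _ _
    refine ⟨⟨?_, ?_⟩, ?_, ?_⟩ <;> simp only [φ] <;> nlinarith
  -- Injectivity keeps the set of singular parameters in the triangle finite.
  have hφinj : ∀ u v u' v', φ u v = φ u' v' → u = u' ∧ v = v' := by
    intro u v u' v' h
    have h1 := congrArg Prod.fst h
    have h2 := congrArg Prod.snd h
    simp only [φ] at h1 h2
    have h1' : u + min u v = u' + min u' v' :=
      mul_right_cancel₀ (sub_pos.2 hab).ne' (by linarith)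
    have h2' : v + min u v = v' + min u' v' :=
      mul_right_cancel₀ (sub_pos.2 hcd).ne' (by linarith)
    rcases le_total u v with huv | huv <;> rcases le_total u' v' with huv' | huv' <;>
      simp only [min_eq_left, min_eq_right, huv, huv'] at h1' h2' <;>
      constructor <;> linarith
  let β : C(stdSimplex ℝ (Fin 3), X) :=
    ⟨fun z => H (φ (z 0) (z 2)), H.continuous.comp
      (hφ.comp ((continuous_coord 0).prodMk (continuous_coord 2)))⟩
  have hsum : ∀ z : stdSimplex ℝ (Fin 3), z 0 + z 1 + z 2 = 1 := fun z => by
    rw [← Fin.sum_univ_three (fun i => z i)]; exact stdSimplex.sum_eq_one z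
  have hmem : ∀ z : stdSimplex ℝ (Fin 3), φ (z 0) (z 2) ∈ Set.Icc a b ×ˢ Set.Icc c d := by
    intro z
    have h1 := stdSimplex.zero_le z 1
    have h := hsum z
    exact hφmem _ _ (stdSimplex.zero_le z 0) (stdSimplex.zero_le z 2) (by linarith)
  have hedge : ∀ u v, 0 ≤ u → 0 ≤ v → u + v = 1 → H (φ u v) ∉ F.singularSet := by
    intro u v hu hv huv
    obtain ⟨hx, hy⟩ := hφmem u v hu hv huv.le
    rcases le_total u v with h | h
    · have e : φ u v = ((φ u v).1, d) := by
        simp only [φ, min_eq_left h, Prod.mk.injEq, true_and]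
        rw [add_comm v, huv]
        ring
      rw [e]
      exact hH.top _ hx
    · have e : φ u v = (a, (φ u v).2) := by
        simp only [φ, min_eq_right h, Prod.mk.injEq, and_true]
        rw [huv]
        ring
      rw [e]
      exact hH.left _ hy
  have hdisk : p.IsDisk β := by
    refine ⟨fun z i hz => ?_, ?_, fun z => hH.admissible _ (hmem z)⟩
    · obtain ⟨hx, hy⟩ := hmem z
      have h0 := stdSimplex.zero_le z 0
      have h2 := stdSimplex.zero_le z 2
      change H (φ (z 0) (z 2)) ∉ _
      fin_cases i
      · have hz' : z 0 = 0 := hz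
        have e : φ (z 0) (z 2) = (b, (φ (z 0) (z 2)).2) := by
          simp [φ, hz', h2]
        rw [e]
        exact hH.right _ hy
      · have hz' : z 1 = 0 := hz
        have h := hsum z
        exact hedge _ _ h0 h2 (by linarith)
      · have hz' : z 2 = 0 := hz
        have e : φ (z 0) (z 2) = ((φ (z 0) (z 2)).1, c) := by
          simp [φ, hz', h0]
        rw [e]
        exact hH.bottom _ hx
    · refine (hH.finite.preimage (f := fun z : stdSimplex ℝ (Fin 3) => φ (z 0) (z 2))
        ?_).subset fun z hz => ⟨hmem z, hz⟩
      intro z _ z' _ h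
      obtain ⟨e0, e2⟩ := hφinj _ _ _ _ h
      have h := hsum z
      have h' := hsum z'
      ext i
      fin_cases i
      · exact e0
      · change z 1 = z' 1
        linarith
      · exact e2
  have h := hw β (fun z => hV _ (hmem z)) hdisk
  -- The bent hypotenuse: its first half is the left side, its second half the top side.
  let ζ : C(ℝ, X) := ⟨fun r => H (φ (1 - r) r), H.continuous.comp
    (hφ.comp (by fun_prop : Continuous fun r : ℝ => (1 - r, r)))⟩
  have e2 : face β 2 = seg (row H c) a b := by
    ext z
    obtain ⟨h0, h1, h2⟩ := face_coords_two z
    have hz := stdSimplex.add_eq_one z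
    have hz1 : z 1 = 1 - z 0 := by linarith
    rw [face_apply]
    change H (φ _ _) = H (z 0 * a + z 1 * b, c)
    rw [h0, h2, hz1]
    simp only [φ, min_eq_right (stdSimplex.zero_le z 0)]
    congr 2 <;> ring
  have e0 : face β 0 = seg (column H b) c d := by
    ext z
    obtain ⟨h0, h1, h2⟩ := face_coords_zero z
    have hz := stdSimplex.add_eq_one z
    have hz0 : z 0 = 1 - z 1 := by linarith
    rw [face_apply]
    change H (φ _ _) = H (b, z 0 * c + z 1 * d)
    rw [h0, h2, hz0]
    simp only [φ, min_eq_left (stdSimplex.zero_le z 1)]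
    congr 2 <;> ring
  have e1 : face β 1 = seg ζ 0 1 := by
    ext z
    obtain ⟨h0, h1, h2⟩ := face_coords_one z
    have hz := stdSimplex.add_eq_one z
    have hz0 : z 0 = 1 - z 1 := by linarith
    rw [face_apply]
    change H (φ _ _) = H (φ (1 - (z 0 * 0 + z 1 * 1)) (z 0 * 0 + z 1 * 1))
    rw [h0, h2, hz0]
    congr 2 <;> ring
  have e3 : seg ζ 0 (1 / 2) = seg (column H a) c d := by
    refine seg_congr fun r hr => ?_
    have hr' : r / 2 ≤ 1 - r / 2 := by linarith [hr.2]
    change H (φ (1 - _) _) = H (a, _)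
    have e : 0 + r * (1 / 2 - 0) = r / 2 := by ring
    rw [e]
    simp only [φ, min_eq_right hr']
    congr 2 <;> ring
  have e4 : seg ζ (1 / 2) 1 = seg (row H d) a b := by
    refine seg_congr fun r hr => ?_
    have hr' : 1 - (1 + r) / 2 ≤ (1 + r) / 2 := by linarith [hr.1]
    change H (φ (1 - _) _) = H (_, d)
    have e : 1 / 2 + r * (1 - 1 / 2) = (1 + r) / 2 := by ring
    rw [e]
    simp only [φ, min_eq_left hr']
    congr 2 <;> ring
  rw [e2, e0, e1] at h
  rw [h, ← e3, ← e4]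
  refine (hw.seg_mul_seg (by norm_num) (by norm_num) ?_ ?_).symm
  · exact fun r hr => hV _ (hφmem _ _ (by linarith [hr.2]) hr.1 (by linarith))
  · exact fun r hr => hedge _ _ (by linarith [hr.2]) hr.1 (by linarith)

end IsMultiplicativeOn

end

end IntersectionHomotopy

namespace IntersectionHomotopy

open Filtration

/-! ### Gluing multiplicative functions on an open cover -/

section

variable {X : Type u} [TopologicalSpace X] {n : ℕ} {F : Filtration X n} {P : Type u} [Group P]
  {ι : Type} {U : ι → Opens X} {p : Perversity F} {w : ι → C(stdSimplex ℝ (Fin 2), X) → P}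

/-- The part of a path between two parameters, reparametrized by the unit interval. -/
def subpath (γ : C(ℝ, X)) (s t : ℝ) : C(ℝ, X) :=
  ⟨fun r => γ (s + r * (t - s)), γ.continuous.comp (by fun_prop)⟩

theorem seg_subpath (γ : C(ℝ, X)) (s t s' t' : ℝ) :
    seg (subpath γ s t) s' t' = seg γ (s + s' * (t - s)) (s + t' * (t - s)) := by
  refine seg_congr fun r _ => ?_
  change γ _ = γ _
  congr 1
  ring

/-- A primitive of a family of partial functions on singular edges along a path: its increments are
the values on the segments that lie in the members of the cover. -/
def IsPrimitive (U : ι → Opens X) (w : ι → C(stdSimplex ℝ (Fin 2), X) → P) (γ : C(ℝ, X))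
    (h : ℝ → P) : Prop :=
  ∀ i s t, 0 ≤ s → s ≤ t → t ≤ 1 → (∀ r ∈ Set.Icc s t, γ r ∈ U i) →
    h s * w i (seg γ s t) = h t

/-- The functions agree on the regular edges in the intersections of the members of the cover. -/
def IsCompatible (F : Filtration X n) (U : ι → Opens X)
    (w : ι → C(stdSimplex ℝ (Fin 2), X) → P) : Prop :=
  ∀ i j (α : C(stdSimplex ℝ (Fin 2), X)),
    (∀ z, α z ∈ U i ∧ α z ∈ U j ∧ α z ∉ F.singularSet) → w i α = w j α

theorem exists_lebesgue_number {E : Type*} [PseudoMetricSpace E] {K : Set E} (hK : IsCompact K)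
    (hU : ∀ x, ∃ i, x ∈ U i) (H : C(E, X)) :
    ∃ δ > 0, ∀ x ∈ K, ∃ i, ∀ y, dist y x < δ → H y ∈ U i := by
  obtain ⟨δ, hδ, h⟩ := lebesgue_number_lemma_of_metric hK
    (fun i => (U i).isOpen.preimage H.continuous)
    (fun x _ => Set.mem_iUnion.2 (hU (H x)))
  refine ⟨δ, hδ, fun x hx => ?_⟩
  obtain ⟨i, hi⟩ := h x hx
  exact ⟨i, fun y hy => hi hy⟩

/-- The primitive is built from left to right in steps of half a Lebesgue number, each step inside
one member of the cover. -/
theorem exists_isPrimitive (hU : ∀ x, ∃ i, x ∈ U i)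
    (hw : ∀ i, IsMultiplicativeOn p (U i : Set X) (w i)) (hcomp : IsCompatible F U w)
    {γ : C(ℝ, X)} (hγ : ∀ r ∈ Set.Icc (0 : ℝ) 1, γ r ∉ F.singularSet) :
    ∃ h, IsPrimitive U w γ h := by
  classical
  obtain ⟨δ, hδ, hleb⟩ := exists_lebesgue_number (isCompact_Icc (a := (0 : ℝ)) (b := 1)) hU γ
  have key : ∀ m : ℕ, ∃ h : ℝ → P, ∀ i s t, 0 ≤ s → s ≤ t → t ≤ 1 → t ≤ m * (δ / 2) →
      (∀ r ∈ Set.Icc s t, γ r ∈ U i) → h s * w i (seg γ s t) = h t := by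
    intro m
    induction m with
    | zero =>
      refine ⟨fun _ => 1, fun i s t hs hst _ ht hi => ?_⟩
      have ht0 : t = 0 := le_antisymm (by simpa using ht) (hs.trans hst)
      have hs0 : s = 0 := le_antisymm (hst.trans ht0.le) hs
      subst ht0 hs0
      rw [(hw i).seg_self (hi 0 (by simp)) (hγ 0 (by simp)), one_mul]
    | succ m ih =>
      obtain ⟨h, hh⟩ := ih
      set T : ℝ := m * (δ / 2) with hT
      have hT0 : 0 ≤ T := by positivity
      have hT' : ((m + 1 : ℕ) : ℝ) * (δ / 2) = T + δ / 2 := by rw [hT]; push_cast; ring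
      by_cases hT1 : 1 < T
      · exact ⟨h, fun i s t hs hst ht _ hi => hh i s t hs hst ht (ht.trans hT1.le) hi⟩
      · obtain ⟨k, hk⟩ := hleb T ⟨hT0, not_lt.1 hT1⟩
        -- Beyond `T` the path stays in `U k`, so `w k` prescribes the increment. A segment in
        -- another member `U i` that reaches beyond `T` is split at `T` if necessary, and there `w
        -- i` equals `w k` by compatibility.
        refine ⟨fun t => if t ≤ T then h t else h T * w k (seg γ T t), ?_⟩
        intro i s t hs hst ht1 ht hi
        rw [hT'] at ht
        have hkU : ∀ r ∈ Set.Icc T t, γ r ∈ U k := by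
          intro r hr
          refine hk r ?_
          rw [Real.dist_eq, abs_of_nonneg (sub_nonneg.2 hr.1)]
          linarith [hr.2]
        have hreg : ∀ r ∈ Set.Icc (0 : ℝ) t, γ r ∉ F.singularSet :=
          fun r hr => hγ r ⟨hr.1, hr.2.trans ht1⟩
        have hcomp' : ∀ a, T ≤ a → s ≤ a → a ≤ t → w i (seg γ a t) = w k (seg γ a t) := by
          intro a hTa hsa hat
          refine hcomp i k _ fun z => ?_
          have hz := combination_mem_Icc hat z
          exact ⟨hi _ ⟨hsa.trans hz.1, hz.2⟩, hkU _ ⟨hTa.trans hz.1, hz.2⟩,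
            hreg _ ⟨(hs.trans hsa).trans hz.1, hz.2⟩⟩
        by_cases htT : t ≤ T
        · simp only [htT, hst.trans htT, if_true]
          exact hh i s t hs hst ht1 htT hi
        · have htT' := not_le.1 htT
          by_cases hsT : s ≤ T
          · simp only [htT, hsT, if_true, if_false]
            rw [← hh i s T hs hsT (not_lt.1 hT1) le_rfl
                fun r hr => hi r ⟨hr.1, hr.2.trans htT'.le⟩,
              ← hcomp' T le_rfl hsT htT'.le, mul_assoc,
              (hw i).seg_mul_seg hsT htT'.le hi fun r hr => hreg r ⟨hs.trans hr.1, hr.2⟩]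
          · have hsT' := not_le.1 hsT
            simp only [htT, hsT, if_false]
            rw [hcomp' s hsT'.le le_rfl hst, mul_assoc, (hw k).seg_mul_seg hsT'.le hst hkU
              fun r hr => hreg r ⟨hT0.trans hr.1, hr.2⟩]
  obtain ⟨m, hm⟩ := exists_nat_ge (1 / (δ / 2))
  obtain ⟨h, hh⟩ := key m
  refine ⟨h, fun i s t hs hst ht hi => hh i s t hs hst ht (ht.trans ?_) hi⟩
  rwa [div_le_iff₀ (by positivity)] at hm

/-- Going back by half a Lebesgue number stays in one member `U k`, so both primitives change by the
same factor `w k` on the right; induction on the number of steps leads back to `0`. -/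
theorem IsPrimitive.unique (hU : ∀ x, ∃ i, x ∈ U i) {γ : C(ℝ, X)} {h h' : ℝ → P}
    (hh : IsPrimitive U w γ h) (hh' : IsPrimitive U w γ h') {t : ℝ} (ht0 : 0 ≤ t) (ht1 : t ≤ 1) :
    (h 0)⁻¹ * h t = (h' 0)⁻¹ * h' t := by
  obtain ⟨δ, hδ, hleb⟩ := exists_lebesgue_number (isCompact_Icc (a := (0 : ℝ)) (b := 1)) hU γ
  have key : ∀ m : ℕ, ∀ t : ℝ, 0 ≤ t → t ≤ 1 → t ≤ m * (δ / 2) →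
      (h 0)⁻¹ * h t = (h' 0)⁻¹ * h' t := by
    intro m
    induction m with
    | zero =>
      intro t ht0 _ ht
      have : t = 0 := le_antisymm (by simpa using ht) ht0
      rw [this, inv_mul_cancel, inv_mul_cancel]
    | succ m ih =>
      intro t ht0 ht1 ht
      have hs0 : 0 ≤ max 0 (t - δ / 2) := le_max_left _ _
      have hst : max 0 (t - δ / 2) ≤ t := max_le ht0 (by linarith)
      have hsm : max 0 (t - δ / 2) ≤ m * (δ / 2) := by
        refine max_le (by positivity) ?_
        push_cast at ht
        linarith
      obtain ⟨k, hk⟩ := hleb t ⟨ht0, ht1⟩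
      have hkU : ∀ r ∈ Set.Icc (max 0 (t - δ / 2)) t, γ r ∈ U k := by
        intro r hr
        refine hk r ?_
        have := (le_max_right _ _).trans hr.1
        rw [Real.dist_eq, abs_sub_comm, abs_of_nonneg (sub_nonneg.2 hr.2)]
        linarith
      rw [← hh k _ t hs0 hst ht1 hkU, ← hh' k _ t hs0 hst ht1 hkU, ← mul_assoc, ← mul_assoc,
        ih _ hs0 (hst.trans ht1) hsm]
  obtain ⟨m, hm⟩ := exists_nat_ge (1 / (δ / 2))
  refine key m t ht0 ht1 (ht1.trans ?_)
  rwa [div_le_iff₀ (by positivity)] at hm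

theorem IsPrimitive.congr {γ γ' : C(ℝ, X)} {h : ℝ → P} (hh : IsPrimitive U w γ h)
    (hγ : ∀ r ∈ Set.Icc (0 : ℝ) 1, γ r = γ' r) : IsPrimitive U w γ' h := by
  intro i s t hs hst ht hi
  have hmem : ∀ r ∈ Set.Icc s t, r ∈ Set.Icc (0 : ℝ) 1 :=
    fun r hr => ⟨hs.trans hr.1, hr.2.trans ht⟩
  have e : seg γ s t = seg γ' s t := by
    ext z
    exact hγ _ (hmem _ (combination_mem_Icc hst z))
  rw [← e]
  exact hh i s t hs hst ht fun r hr => by rw [hγ r (hmem r hr)]; exact hi r hr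

theorem IsPrimitive.subpath {γ : C(ℝ, X)} {h : ℝ → P} (hh : IsPrimitive U w γ h) {s t : ℝ}
    (hs : 0 ≤ s) (hst : s ≤ t) (ht : t ≤ 1) :
    IsPrimitive U w (subpath γ s t) fun r => h (s + r * (t - s)) := by
  intro i s' t' hs' hst' ht' hi
  have hd : 0 ≤ t - s := sub_nonneg.2 hst
  rw [seg_subpath]
  refine hh i _ _ (by positivity) (by gcongr) (by nlinarith) fun r hr => ?_
  -- If `s = t` the reparametrization is constant and cannot be inverted by a division.
  rcases hd.eq_or_lt with hd | hd
  · rw [← hd, mul_zero, mul_zero] at hr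
    have hr' : r = s + s' * (t - s) := by
      rw [← hd, mul_zero]
      exact le_antisymm hr.2 hr.1
    rw [hr']
    exact hi s' ⟨le_rfl, hst'⟩
  · have e : r = s + (r - s) / (t - s) * (t - s) := by
      field_simp
      ring
    rw [e]
    refine hi _ ⟨?_, ?_⟩
    · rw [le_div_iff₀ hd]
      linarith [hr.1]
    · rw [div_le_iff₀ hd]
      linarith [hr.2]

open Classical in
/-- The increment of a primitive along a path. -/
noncomputable def pathValue (U : ι → Opens X) (w : ι → C(stdSimplex ℝ (Fin 2), X) → P)
    (γ : C(ℝ, X)) : P :=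
  if hγ : ∃ h, IsPrimitive U w γ h then (hγ.choose 0)⁻¹ * hγ.choose 1 else 1

theorem IsPrimitive.pathValue_eq (hU : ∀ x, ∃ i, x ∈ U i) {γ : C(ℝ, X)} {h : ℝ → P}
    (hh : IsPrimitive U w γ h) : pathValue U w γ = (h 0)⁻¹ * h 1 := by
  have hex : ∃ h, IsPrimitive U w γ h := ⟨h, hh⟩
  rw [pathValue, dif_pos hex]
  exact hex.choose_spec.unique hU hh zero_le_one le_rfl

theorem IsPrimitive.pathValue_subpath (hU : ∀ x, ∃ i, x ∈ U i) {γ : C(ℝ, X)} {h : ℝ → P}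
    (hh : IsPrimitive U w γ h) {s t : ℝ} (hs : 0 ≤ s) (hst : s ≤ t) (ht : t ≤ 1) :
    pathValue U w (IntersectionHomotopy.subpath γ s t) = (h s)⁻¹ * h t := by
  rw [(hh.subpath hs hst ht).pathValue_eq hU]
  simp

/-- Paths are defined on the whole line, but only the unit interval counts: both paths have the same
primitives, hence the same chosen one. -/
theorem pathValue_congr {γ γ' : C(ℝ, X)} (hγ : ∀ r ∈ Set.Icc (0 : ℝ) 1, γ r = γ' r) :
    pathValue U w γ = pathValue U w γ' := by
  have : IsPrimitive U w γ = IsPrimitive U w γ' :=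
    funext fun h => propext ⟨fun hh => hh.congr hγ, fun hh => hh.congr fun r hr => (hγ r hr).symm⟩
  rw [pathValue, pathValue, this]

/-- One primitive of the whole path restricts to all three subpaths, and its increments telescope.
-/
theorem pathValue_mul (hU : ∀ x, ∃ i, x ∈ U i)
    (hw : ∀ i, IsMultiplicativeOn p (U i : Set X) (w i)) (hcomp : IsCompatible F U w)
    {γ : C(ℝ, X)} (hγ : ∀ r ∈ Set.Icc (0 : ℝ) 1, γ r ∉ F.singularSet)
    {s t u : ℝ} (hs : 0 ≤ s) (hst : s ≤ t) (htu : t ≤ u) (hu : u ≤ 1) :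
    pathValue U w (subpath γ s t) * pathValue U w (subpath γ t u) =
      pathValue U w (subpath γ s u) := by
  obtain ⟨h, hh⟩ := exists_isPrimitive hU hw hcomp hγ
  rw [hh.pathValue_subpath hU hs hst (htu.trans hu), hh.pathValue_subpath hU (hs.trans hst) htu hu,
    hh.pathValue_subpath hU hs (hst.trans htu) hu]
  group

theorem pathValue_eq_of_mem (hU : ∀ x, ∃ i, x ∈ U i)
    (hw : ∀ i, IsMultiplicativeOn p (U i : Set X) (w i)) (hcomp : IsCompatible F U w)
    {γ : C(ℝ, X)} (hγ : ∀ r ∈ Set.Icc (0 : ℝ) 1, γ r ∉ F.singularSet)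
    {s t : ℝ} (hs : 0 ≤ s) (hst : s ≤ t) (ht : t ≤ 1) {i : ι}
    (hi : ∀ r ∈ Set.Icc s t, γ r ∈ U i) :
    pathValue U w (subpath γ s t) = w i (seg γ s t) := by
  obtain ⟨h, hh⟩ := exists_isPrimitive hU hw hcomp hγ
  rw [hh.pathValue_subpath hU hs hst ht, ← hh i s t hs hst ht hi, inv_mul_cancel_left]

/-- Induction over the intervals with end points in a subset of the unit interval with finite
complement. -/
theorem interval_induction {Q : ℝ → ℝ → Prop} {G : Set ℝ} (hG : (Set.Icc 0 1 \ G).Finite) {δ : ℝ}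
    (hδ : 0 < δ)
    (hsmall : ∀ a ∈ G, ∀ b ∈ G, 0 ≤ a → a < b → b ≤ 1 → b - a < δ → Q a b)
    (hadd : ∀ a ∈ G, ∀ m ∈ G, ∀ b ∈ G, 0 ≤ a → a < m → m < b → b ≤ 1 → Q a m → Q m b → Q a b)
    {a b : ℝ} (ha : a ∈ G) (hb : b ∈ G) (ha0 : 0 ≤ a) (hab : a < b) (hb1 : b ≤ 1) : Q a b := by
  have key : ∀ N : ℕ, ∀ a ∈ G, ∀ b ∈ G, 0 ≤ a → a < b → b ≤ 1 → b - a ≤ N * (δ / 2) → Q a b := by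
    intro N
    induction N with
    | zero =>
      intro a _ b _ _ hab _ h
      simp only [CharP.cast_eq_zero, zero_mul] at h
      linarith
    | succ N ih =>
      intro a ha b hb ha0 hab hb1 h
      by_cases hsm : b - a < δ
      · exact hsmall a ha b hb ha0 hab hb1 hsm
      -- An open interval of parameters cannot be exhausted by the finite complement of `G`. The cut
      -- at `m` leaves a first piece shorter than `δ` and shortens the rest by more than `δ / 2`.
      · obtain ⟨m, hm, hmG⟩ := ((Set.Ioo_infinite (show a + δ / 2 < a + δ by linarith)).sdiff
          hG).nonempty
        have hmb : m < b := by linarith [hm.2]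
        have ham : a < m := by linarith [hm.1]
        have hmG' : m ∈ G := by
          by_contra hmG'
          exact hmG ⟨⟨ha0.trans ham.le, hmb.le.trans hb1⟩, hmG'⟩
        refine hadd a ha m hmG' b hb ha0 ham hmb hb1
          (hsmall a ha m hmG' ha0 ham (hmb.le.trans hb1) (by linarith [hm.2]))
          (ih m hmG' b hb (ha0.trans ham.le) hmb hb1 ?_)
        push_cast at h
        linarith [hm.1]
  obtain ⟨N, hN⟩ := exists_nat_ge (1 / (δ / 2))
  rw [div_le_iff₀ (by positivity)] at hN
  exact key N a ha b hb ha0 hab hb1 (by linarith)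

/-- The square is cut into rectangles that are small enough to lie in a member of the cover and have
regular sides. Their identities are pasted along a row into a strip, and then the strips are
stacked; the inner sides cancel. -/
theorem pathValue_rectangle (hU : ∀ x, ∃ i, x ∈ U i)
    (hw : ∀ i, IsMultiplicativeOn p (U i : Set X) (w i)) (hcomp : IsCompatible F U w)
    {H : C(ℝ × ℝ, X)} (hH : IsDiskOn p H 0 1 0 1) :
    pathValue U w (subpath (row H 0) 0 1) * pathValue U w (subpath (column H 1) 0 1) =
      pathValue U w (subpath (column H 0) 0 1) * pathValue U w (subpath (row H 1) 0 1) := by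
  -- The admissible vertical and horizontal cuts; the excluded positions are projections of the
  -- finitely many singular points.
  let A : Set ℝ := {a | a ∈ Set.Icc (0 : ℝ) 1 ∧ ∀ y ∈ Set.Icc (0 : ℝ) 1, H (a, y) ∉ F.singularSet}
  let B : Set ℝ := {c | c ∈ Set.Icc (0 : ℝ) 1 ∧ ∀ x ∈ Set.Icc (0 : ℝ) 1, H (x, c) ∉ F.singularSet}
  have hA : (Set.Icc 0 1 \ A).Finite := by
    refine (hH.finite.image Prod.fst).subset ?_
    rintro a ⟨ha, haA⟩
    simp only [A, Set.mem_ofPred_eq, not_and, not_forall, not_not] at haA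
    obtain ⟨y, hy, hs⟩ := haA ha
    exact ⟨(a, y), ⟨⟨ha, hy⟩, hs⟩, rfl⟩
  have hB : (Set.Icc 0 1 \ B).Finite := by
    refine (hH.finite.image Prod.snd).subset ?_
    rintro c ⟨hc, hcB⟩
    simp only [B, Set.mem_ofPred_eq, not_and, not_forall, not_not] at hcB
    obtain ⟨x, hx, hs⟩ := hcB hc
    exact ⟨(x, c), ⟨⟨hx, hc⟩, hs⟩, rfl⟩
  have h01 : (0 : ℝ) ∈ Set.Icc (0 : ℝ) 1 := by simp
  have h11 : (1 : ℝ) ∈ Set.Icc (0 : ℝ) 1 := by simp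
  obtain ⟨δ, hδ, hleb⟩ := exists_lebesgue_number
    ((isCompact_Icc (a := (0 : ℝ)) (b := 1)).prod (isCompact_Icc (a := (0 : ℝ)) (b := 1))) hU H
  let R : ℝ → ℝ → ℝ → ℝ → Prop := fun a b c d =>
    pathValue U w (subpath (row H c) a b) * pathValue U w (subpath (column H b) c d) =
      pathValue U w (subpath (column H a) c d) * pathValue U w (subpath (row H d) a b)
  change R 0 1 0 1
  have hsmall : ∀ c ∈ B, ∀ d ∈ B, 0 ≤ c → c < d → d ≤ 1 → d - c < δ →
      ∀ a ∈ A, ∀ b ∈ A, 0 ≤ a → a < b → b ≤ 1 → b - a < δ → R a b c d := by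
    intro c hc d hd hc0 hcd hd1 hcdδ a ha b hb ha0 hab hb1 habδ
    have hsub : Set.Icc a b ×ˢ Set.Icc c d ⊆ Set.Icc (0 : ℝ) 1 ×ˢ Set.Icc (0 : ℝ) 1 :=
      Set.prod_mono (Set.Icc_subset_Icc ha0 hb1) (Set.Icc_subset_Icc hc0 hd1)
    obtain ⟨i, hi⟩ := hleb (a, c) ⟨ha.1, hc.1⟩
    have hV : ∀ q ∈ Set.Icc a b ×ˢ Set.Icc c d, H q ∈ U i := by
      rintro ⟨x, y⟩ ⟨hx, hy⟩
      refine hi _ ?_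
      rw [Prod.dist_eq, Real.dist_eq, Real.dist_eq, abs_of_nonneg (sub_nonneg.2 hx.1),
        abs_of_nonneg (sub_nonneg.2 hy.1)]
      exact max_lt (by linarith [hx.2]) (by linarith [hy.2])
    have hD : IsDiskOn p H a b c d :=
      ⟨fun y hy => ha.2 y (Set.Icc_subset_Icc hc0 hd1 hy),
        fun y hy => hb.2 y (Set.Icc_subset_Icc hc0 hd1 hy),
        fun x hx => hc.2 x (Set.Icc_subset_Icc ha0 hb1 hx),
        fun x hx => hd.2 x (Set.Icc_subset_Icc ha0 hb1 hx),
        hH.finite.subset fun q hq => ⟨hsub hq.1, hq.2⟩, fun q hq => hH.admissible q (hsub hq)⟩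
    have h := (hw i).rectangle hab hcd hV hD
    have hac : a ∈ Set.Icc a b := ⟨le_rfl, hab.le⟩
    have hbc : b ∈ Set.Icc a b := ⟨hab.le, le_rfl⟩
    have hcc : c ∈ Set.Icc c d := ⟨le_rfl, hcd.le⟩
    have hdc : d ∈ Set.Icc c d := ⟨hcd.le, le_rfl⟩
    change pathValue U w (subpath (row H c) a b) * pathValue U w (subpath (column H b) c d) =
      pathValue U w (subpath (column H a) c d) * pathValue U w (subpath (row H d) a b)
    rwa [pathValue_eq_of_mem hU hw hcomp (γ := row H c) hc.2 ha0 hab.le hb1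
        (fun x hx => hV (x, c) ⟨hx, hcc⟩),
      pathValue_eq_of_mem hU hw hcomp (γ := row H d) hd.2 ha0 hab.le hb1
        (fun x hx => hV (x, d) ⟨hx, hdc⟩),
      pathValue_eq_of_mem hU hw hcomp (γ := column H a) ha.2 hc0 hcd.le hd1
        (fun y hy => hV (a, y) ⟨hac, hy⟩),
      pathValue_eq_of_mem hU hw hcomp (γ := column H b) hb.2 hc0 hcd.le hd1
        (fun y hy => hV (b, y) ⟨hbc, hy⟩)]
  have hstrip : ∀ c ∈ B, ∀ d ∈ B, 0 ≤ c → c < d → d ≤ 1 → d - c < δ → R 0 1 c d := by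
    intro c hc d hd hc0 hcd hd1 hcdδ
    refine interval_induction (Q := fun a b => R a b c d) hA hδ
      (hsmall c hc d hd hc0 hcd hd1 hcdδ) ?_ ⟨h01, hH.left⟩ ⟨h11, hH.right⟩ le_rfl zero_lt_one
      le_rfl
    intro a _ m _ b _ ha0 ham hmb hb1 h1 h2
    simp only [R] at h1 h2 ⊢
    rw [← pathValue_mul hU hw hcomp (γ := row H c) hc.2 ha0 ham.le hmb.le hb1,
      ← pathValue_mul hU hw hcomp (γ := row H d) hd.2 ha0 ham.le hmb.le hb1, mul_assoc, h2,
      ← mul_assoc, h1, mul_assoc]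
  refine interval_induction (Q := fun c d => R 0 1 c d) hB hδ hstrip ?_ ⟨h01, hH.bottom⟩
    ⟨h11, hH.top⟩ le_rfl zero_lt_one le_rfl
  intro c _ m _ d _ hc0 hcm hmd hd1 h1 h2
  simp only [R] at h1 h2 ⊢
  rw [← pathValue_mul hU hw hcomp (γ := column H 0) hH.left hc0 hcm.le hmd.le hd1,
    ← pathValue_mul hU hw hcomp (γ := column H 1) hH.right hc0 hcm.le hmd.le hd1, ← mul_assoc, h1,
    mul_assoc, h2, mul_assoc]

end

end IntersectionHomotopy

namespace IntersectionHomotopy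

open Filtration

/-! ### Parametrizing edges by intervals and triangles by squares; the glued function -/

section

variable {X : Type u} [TopologicalSpace X] {n : ℕ} {F : Filtration X n} {P : Type u} [Group P]
  {ι : Type} {U : ι → Opens X} {p : Perversity F} {w : ι → C(stdSimplex ℝ (Fin 2), X) → P}

/-- The retraction of the real line to the unit interval. -/
noncomputable def clamp (t : ℝ) : ℝ := max 0 (min 1 t)

theorem continuous_clamp : Continuous clamp := by
  unfold clamp
  fun_prop

theorem clamp_nonneg (t : ℝ) : 0 ≤ clamp t := le_max_left _ _

theorem clamp_le_one (t : ℝ) : clamp t ≤ 1 := max_le zero_le_one (min_le_left _ _)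

theorem clamp_eq {t : ℝ} (ht : t ∈ Set.Icc (0 : ℝ) 1) : clamp t = t := by
  rw [clamp, min_eq_right ht.2, max_eq_right ht.1]

/-- The parametrization of the `1`-simplex by the unit interval, extended to the real line. -/
noncomputable def edgePoint (t : ℝ) : stdSimplex ℝ (Fin 2) :=
  ⟨![1 - clamp t, clamp t], fun i => by
    have h0 := clamp_nonneg t
    have h1 := clamp_le_one t
    fin_cases i <;> simp [h0, h1], by simp⟩

theorem edgePoint_zero (t : ℝ) : edgePoint t 0 = 1 - clamp t := rfl

theorem edgePoint_one (t : ℝ) : edgePoint t 1 = clamp t := rfl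

theorem continuous_edgePoint : Continuous edgePoint := by
  refine Continuous.subtype_mk (continuous_pi fun i => ?_) _
  fin_cases i
  · exact continuous_const.sub continuous_clamp
  · exact continuous_clamp

/-- The path that underlies a singular edge. -/
noncomputable def edgePath (α : C(stdSimplex ℝ (Fin 2), X)) : C(ℝ, X) :=
  α.comp ⟨edgePoint, continuous_edgePoint⟩

theorem edgePath_apply (α : C(stdSimplex ℝ (Fin 2), X)) (t : ℝ) :
    edgePath α t = α (edgePoint t) := rfl

theorem seg_edgePath (α : C(stdSimplex ℝ (Fin 2), X)) : seg (edgePath α) 0 1 = α := by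
  ext z
  rw [seg_apply, edgePath_apply]
  congr 1
  have h := stdSimplex.add_eq_one z
  have e : z 0 * 0 + z 1 * 1 = z 1 := by ring
  have hc : clamp (z 1) = z 1 := clamp_eq ⟨stdSimplex.zero_le z 1, stdSimplex.le_one z 1⟩
  rw [e]
  ext i
  fin_cases i
  · change edgePoint (z 1) 0 = z 0
    rw [edgePoint_zero, hc]
    linarith
  · change edgePoint (z 1) 1 = z 1
    rw [edgePoint_one, hc]

theorem subpath_zero_one (γ : C(ℝ, X)) : subpath γ 0 1 = γ := by
  ext r
  change γ _ = γ _
  congr 1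
  ring

/-- The parametrization of the `2`-simplex by the unit square, extended to the plane, that sends the
left and the top side to the face opposite to the middle vertex. -/
noncomputable def squarePoint (q : ℝ × ℝ) : stdSimplex ℝ (Fin 3) :=
  ⟨![(1 - clamp q.1) - min (1 - clamp q.1) (clamp q.2) / 2, 1 - max (1 - clamp q.1) (clamp q.2),
      clamp q.2 - min (1 - clamp q.1) (clamp q.2) / 2], by
    have h1 := clamp_nonneg q.1
    have h2 := clamp_le_one q.1
    have h3 := clamp_nonneg q.2
    have h4 := clamp_le_one q.2
    constructor
    · intro i
      have h5 := min_le_left (1 - clamp q.1) (clamp q.2)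
      have h6 := min_le_right (1 - clamp q.1) (clamp q.2)
      have h7 : max (1 - clamp q.1) (clamp q.2) ≤ 1 := max_le (by linarith) h4
      fin_cases i <;> simp <;> first | linarith | exact ⟨h1, h4⟩
    · have h := min_add_max (1 - clamp q.1) (clamp q.2)
      simp only [Fin.sum_univ_three, Matrix.cons_val_zero, Matrix.cons_val_one, Matrix.cons_val]
      linarith⟩

theorem squarePoint_coords {x y : ℝ} (hx : x ∈ Set.Icc (0 : ℝ) 1) (hy : y ∈ Set.Icc (0 : ℝ) 1) :
    squarePoint (x, y) 0 = (1 - x) - min (1 - x) y / 2 ∧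
    squarePoint (x, y) 1 = 1 - max (1 - x) y ∧
    squarePoint (x, y) 2 = y - min (1 - x) y / 2 := by
  have h : ((squarePoint (x, y) : stdSimplex ℝ (Fin 3)) : Fin 3 → ℝ) =
      ![(1 - x) - min (1 - x) y / 2, 1 - max (1 - x) y, y - min (1 - x) y / 2] := by
    simp only [squarePoint, clamp_eq hx, clamp_eq hy]
    rfl
  exact ⟨congrFun h 0, congrFun h 1, congrFun h 2⟩

theorem continuous_squarePoint : Continuous squarePoint := by
  have h1 : Continuous fun q : ℝ × ℝ => clamp q.1 := continuous_clamp.comp continuous_fst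
  have h2 : Continuous fun q : ℝ × ℝ => clamp q.2 := continuous_clamp.comp continuous_snd
  refine Continuous.subtype_mk (continuous_pi fun i => ?_) _
  fin_cases i
  · exact (continuous_const.sub h1).sub (((continuous_const.sub h1).min h2).div_const 2)
  · exact continuous_const.sub ((continuous_const.sub h1).max h2)
  · exact h2.sub (((continuous_const.sub h1).min h2).div_const 2)

/-- On the unit square, the map `φ` in the proof of `IsMultiplicativeOn.rectangle` with `a = c = 0`
and `b = d = 1` recovers the point from coordinates `0` and `2` of its image. -/
theorem squarePoint_injOn :
    Set.InjOn squarePoint (Set.Icc (0 : ℝ) 1 ×ˢ Set.Icc (0 : ℝ) 1) := by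
  rintro ⟨x, y⟩ ⟨hx, hy⟩ ⟨x', y'⟩ ⟨hx', hy'⟩ h
  obtain ⟨a0, a1, a2⟩ := squarePoint_coords hx hy
  obtain ⟨b0, b1, b2⟩ := squarePoint_coords hx' hy'
  rw [h, b0] at a0
  rw [h, b1] at a1
  rw [h, b2] at a2
  have : x = x' ∧ y = y' := by
    rcases le_total (1 - x) y with h1 | h1 <;> rcases le_total (1 - x') y' with h2 | h2 <;>
      simp only [min_eq_left, min_eq_right, max_eq_left, max_eq_right, h1, h2] at a0 a1 a2 <;>
      constructor <;> linarith
  exact Prod.ext this.1 this.2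

/-- The four sides go to the boundary of the triangle, and injectivity carries finiteness over. -/
theorem isDiskOn_squarePoint {β : C(stdSimplex ℝ (Fin 3), X)} (hβ : p.IsDisk β) :
    IsDiskOn p (β.comp ⟨squarePoint, continuous_squarePoint⟩) 0 1 0 1 where
  left y hy := by
    refine hβ.boundary _ 1 ((squarePoint_coords (by simp) hy).2.1.trans ?_)
    simp [hy.2]
  right y hy := by
    refine hβ.boundary _ 0 ((squarePoint_coords (by simp) hy).1.trans ?_)
    simp [hy.1]
  bottom x hx := by
    refine hβ.boundary _ 2 ((squarePoint_coords hx (by simp)).2.2.trans ?_)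
    simp [hx.2]
  top x hx := by
    refine hβ.boundary _ 1 ((squarePoint_coords hx (by simp)).2.1.trans ?_)
    simp [hx.1]
  finite := by
    refine Set.Finite.of_finite_image (f := squarePoint) (hβ.finite.subset ?_)
      (squarePoint_injOn.mono fun q hq => hq.1)
    rintro _ ⟨q, hq, rfl⟩
    exact hq.2
  admissible q _ := hβ.admissible _

theorem IsDisk.face_regular {β : C(stdSimplex ℝ (Fin 3), X)} (hβ : p.IsDisk β) (i : Fin 3)
    (z : stdSimplex ℝ (Fin 2)) : face β i z ∉ F.singularSet :=
  hβ.boundary _ i (stdSimplex_map_apply_eq_zero _ _ (by simp))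

theorem stdSimplex_ext_three {z z' : stdSimplex ℝ (Fin 3)} (h0 : z 0 = z' 0) (h1 : z 1 = z' 1)
    (h2 : z 2 = z' 2) : z = z' := by
  ext i
  fin_cases i
  exacts [h0, h1, h2]

/-- The function on singular edges that is glued from a compatible family. -/
noncomputable def glue (U : ι → Opens X) (w : ι → C(stdSimplex ℝ (Fin 2), X) → P)
    (α : C(stdSimplex ℝ (Fin 2), X)) : P :=
  pathValue U w (edgePath α)

theorem glue_eq (hU : ∀ x, ∃ i, x ∈ U i)
    (hw : ∀ i, IsMultiplicativeOn p (U i : Set X) (w i)) (hcomp : IsCompatible F U w) {i : ι}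
    {α : C(stdSimplex ℝ (Fin 2), X)} (hα : ∀ z, α z ∉ F.singularSet) (hi : ∀ z, α z ∈ U i) :
    glue U w α = w i α := by
  rw [glue, ← subpath_zero_one (edgePath α), pathValue_eq_of_mem hU hw hcomp
    (fun r _ => hα _) le_rfl zero_le_one le_rfl (fun r _ => hi _), seg_edgePath]

/-- Under `squarePoint` the bottom and right sides become faces `2` and `0`, while the left side
followed by the top side traverses face `1`; the identity of the square is the cocycle identity. -/
theorem isMultiplicativeOn_glue (hU : ∀ x, ∃ i, x ∈ U i)
    (hw : ∀ i, IsMultiplicativeOn p (U i : Set X) (w i)) (hcomp : IsCompatible F U w) :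
    IsMultiplicativeOn p Set.univ (glue U w) := by
  intro β _ hβ
  have h := pathValue_rectangle hU hw hcomp (isDiskOn_squarePoint hβ)
  set H : C(ℝ × ℝ, X) := β.comp ⟨squarePoint, continuous_squarePoint⟩ with hH
  have e2 : pathValue U w (subpath (row H 0) 0 1) = glue U w (face β 2) := by
    refine pathValue_congr fun r hr => ?_
    rw [subpath_zero_one, edgePath_apply, face_apply]
    change β (squarePoint (r, 0)) = β _
    obtain ⟨a0, a1, a2⟩ := squarePoint_coords hr (show (0 : ℝ) ∈ Set.Icc (0 : ℝ) 1 by simp)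
    obtain ⟨b0, b1, b2⟩ := face_coords_two (edgePoint r)
    rw [edgePoint_zero, clamp_eq hr] at b0
    rw [edgePoint_one, clamp_eq hr] at b1
    have hr' : 0 ≤ 1 - r := sub_nonneg.2 hr.2
    congr 1
    refine stdSimplex_ext_three ?_ ?_ ?_
    · rw [a0, b0, min_eq_right hr']; ring
    · rw [a1, b1, max_eq_left hr']; ring
    · rw [a2, b2, min_eq_right hr']; ring
  have e0 : pathValue U w (subpath (column H 1) 0 1) = glue U w (face β 0) := by
    refine pathValue_congr fun r hr => ?_
    rw [subpath_zero_one, edgePath_apply, face_apply]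
    change β (squarePoint (1, r)) = β _
    obtain ⟨a0, a1, a2⟩ := squarePoint_coords (show (1 : ℝ) ∈ Set.Icc (0 : ℝ) 1 by simp) hr
    obtain ⟨b0, b1, b2⟩ := face_coords_zero (edgePoint r)
    rw [edgePoint_zero, clamp_eq hr] at b1
    rw [edgePoint_one, clamp_eq hr] at b2
    have hr' : (1 : ℝ) - 1 ≤ r := by linarith [hr.1]
    congr 1
    refine stdSimplex_ext_three ?_ ?_ ?_
    · rw [a0, b0, min_eq_left hr']; ring
    · rw [a1, b1, max_eq_right hr']
    · rw [a2, b2, min_eq_left hr']; ring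
  have hmem : ∀ r ∈ Set.Icc (0 : ℝ) 1, 0 + r * (1 / 2 - 0) ∈ Set.Icc (0 : ℝ) 1 :=
    fun r hr => ⟨by linarith [hr.1], by linarith [hr.2]⟩
  have hmem' : ∀ r ∈ Set.Icc (0 : ℝ) 1, 1 / 2 + r * (1 - 1 / 2) ∈ Set.Icc (0 : ℝ) 1 :=
    fun r hr => ⟨by linarith [hr.1], by linarith [hr.2]⟩
  -- The corner `(0, 1)` goes to the midpoint of face `1`, so the left side is its first half.
  have e3 : pathValue U w (subpath (column H 0) 0 1) =
      pathValue U w (subpath (edgePath (face β 1)) 0 (1 / 2)) := by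
    refine pathValue_congr fun r hr => ?_
    rw [subpath_zero_one]
    change β (squarePoint (0, r)) = β (stdSimplex.map _ (edgePoint (0 + r * (1 / 2 - 0))))
    obtain ⟨a0, a1, a2⟩ := squarePoint_coords (show (0 : ℝ) ∈ Set.Icc (0 : ℝ) 1 by simp) hr
    obtain ⟨b0, b1, b2⟩ := face_coords_one (edgePoint (0 + r * (1 / 2 - 0)))
    rw [edgePoint_zero, clamp_eq (hmem r hr)] at b0
    rw [edgePoint_one, clamp_eq (hmem r hr)] at b2
    have hr' : r ≤ 1 - 0 := by linarith [hr.2]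
    congr 1
    refine stdSimplex_ext_three ?_ ?_ ?_
    · rw [a0, b0, min_eq_right hr']; ring
    · rw [a1, b1, max_eq_left hr']; ring
    · rw [a2, b2, min_eq_right hr']; ring
  have e4 : pathValue U w (subpath (row H 1) 0 1) =
      pathValue U w (subpath (edgePath (face β 1)) (1 / 2) 1) := by
    refine pathValue_congr fun r hr => ?_
    rw [subpath_zero_one]
    change β (squarePoint (r, 1)) = β (stdSimplex.map _ (edgePoint (1 / 2 + r * (1 - 1 / 2))))
    obtain ⟨a0, a1, a2⟩ := squarePoint_coords hr (show (1 : ℝ) ∈ Set.Icc (0 : ℝ) 1 by simp)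
    obtain ⟨b0, b1, b2⟩ := face_coords_one (edgePoint (1 / 2 + r * (1 - 1 / 2)))
    rw [edgePoint_zero, clamp_eq (hmem' r hr)] at b0
    rw [edgePoint_one, clamp_eq (hmem' r hr)] at b2
    have hr' : 1 - r ≤ 1 := by linarith [hr.1]
    congr 1
    refine stdSimplex_ext_three ?_ ?_ ?_
    · rw [a0, b0, min_eq_left hr']; ring
    · rw [a1, b1, max_eq_right hr']; ring
    · rw [a2, b2, min_eq_left hr']; ring
  rw [e2, e0, e3, e4, pathValue_mul hU hw hcomp (fun r _ => IsDisk.face_regular hβ 1 _) le_rfl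
    (by norm_num) (by norm_num) le_rfl, subpath_zero_one] at h
  exact h

/-- Integrating `w` and `w'` along the edge gives two primitives of the same constant family, since
`w` and `w'` agree on segments in members of the cover; uniqueness applies. -/
theorem IsMultiplicativeOn.eq_of_cover (hU : ∀ x, ∃ i, x ∈ U i)
    {w w' : C(stdSimplex ℝ (Fin 2), X) → P} (hw : IsMultiplicativeOn p Set.univ w)
    (hw' : IsMultiplicativeOn p Set.univ w')
    (h : ∀ i α, (∀ z, α z ∉ F.singularSet) → (∀ z, α z ∈ U i) → w α = w' α)
    {α : C(stdSimplex ℝ (Fin 2), X)} (hα : ∀ z, α z ∉ F.singularSet) : w α = w' α := by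
  have hreg : ∀ r, edgePath α r ∉ F.singularSet := fun r => hα _
  have h1 : IsPrimitive U (fun _ => w) (edgePath α) fun t => w (seg (edgePath α) 0 t) :=
    fun i s t hs hst _ _ => hw.seg_mul_seg hs hst (fun _ _ => trivial) fun r _ => hreg r
  have h2 : IsPrimitive U (fun _ => w) (edgePath α) fun t => w' (seg (edgePath α) 0 t) := by
    intro i s t hs hst _ hi
    have e : w (seg (edgePath α) s t) = w' (seg (edgePath α) s t) :=
      h i _ (fun z => hreg _) fun z => hi _ (combination_mem_Icc hst z)
    simp only [e]
    exact hw'.seg_mul_seg hs hst (fun _ _ => trivial) fun r _ => hreg r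
  have h3 := h1.unique hU h2 zero_le_one le_rfl
  simp only [seg_edgePath] at h3
  rwa [hw.seg_self trivial (hreg 0), hw'.seg_self trivial (hreg 0), inv_one, one_mul,
    one_mul] at h3

end

end IntersectionHomotopy

namespace IntersectionHomotopy

open Filtration Simplicial

/-! ### Gluing cocycles on the Gajer spaces of an open cover -/

section

variable {X : Type u} [TopologicalSpace X] {n : ℕ} {F : Filtration X n} {P : Type u} [Group P]
  {ι : Type} {U : ι → Opens X} {p : Perversity F} {V : Opens X}

/-- A map to an open subset. -/
def restrictTo {k : ℕ} (V : Opens X) (α : C(stdSimplex ℝ (Fin k), X)) (hα : ∀ z, α z ∈ V) :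
    C(stdSimplex ℝ (Fin k), V) :=
  ⟨fun z => ⟨α z, hα z⟩, α.continuous.subtype_mk _⟩

theorem Perversity.IsDisk.restrictTo {β : C(stdSimplex ℝ (Fin 3), X)} (hβ : p.IsDisk β)
    (hV : ∀ z, β z ∈ V) : (p.induced V).IsDisk (restrictTo V β hV) where
  boundary z i hz := hβ.boundary z i hz
  finite := hβ.finite
  admissible z := (hβ.admissible z).induced

open Classical in
/-- The function on singular edges of `X` that is given by a function on the edges of the Gajer
space of an open subset. -/
noncomputable def edgeValueOn (v : ((p.induced V).gajer : SSet.{u}) _⦋1⦌ → P)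
    (α : C(stdSimplex ℝ (Fin 2), X)) : P :=
  if h : (∀ z, α z ∈ V) ∧ ∀ z, α z ∉ F.singularSet then
    v ((p.induced V).mkRegular (restrictTo V α h.1) h.2) else 1

theorem edgeValueOn_eq (v : ((p.induced V).gajer : SSet.{u}) _⦋1⦌ → P)
    {α : C(stdSimplex ℝ (Fin 2), X)} (hV : ∀ z, α z ∈ V) (hα : ∀ z, α z ∉ F.singularSet) :
    edgeValueOn v α = v ((p.induced V).mkRegular (restrictTo V α hV) hα) :=
  dif_pos ⟨hV, hα⟩

/-- The faces of a full triangle in `V` are regular edges in `V`, so the default value `1` is never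
met. -/
theorem isMultiplicativeOn_edgeValueOn {v : ((p.induced V).gajer : SSet.{u}) _⦋1⦌ → P}
    (hv : IsCocycle v) : IsMultiplicativeOn p (V : Set X) (edgeValueOn v) := by
  intro β hV hβ
  have h := hv ((p.induced V).mkDisk _ (hβ.restrictTo hV))
  have e : ∀ i, v (((p.induced V).gajer : SSet.{u}).δ i
      ((p.induced V).mkDisk _ (hβ.restrictTo hV))) = edgeValueOn v (face β i) :=
    fun i => (congrArg v (Perversity.eval_injective rfl)).trans
      (edgeValueOn_eq v (fun z => hV _) (IsDisk.face_regular hβ i)).symm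
  rwa [e, e, e] at h

open Classical in
/-- The function on singular edges that is given by a function on the edges of the Gajer space. -/
noncomputable def edgeValue (v : (p.gajer : SSet.{u}) _⦋1⦌ → P)
    (α : C(stdSimplex ℝ (Fin 2), X)) : P :=
  if h : ∀ z, α z ∉ F.singularSet then v (p.mkRegular α h) else 1

theorem edgeValue_eq (v : (p.gajer : SSet.{u}) _⦋1⦌ → P)
    {α : C(stdSimplex ℝ (Fin 2), X)} (hα : ∀ z, α z ∉ F.singularSet) :
    edgeValue v α = v (p.mkRegular α hα) :=
  dif_pos hα

theorem isMultiplicativeOn_edgeValue {v : (p.gajer : SSet.{u}) _⦋1⦌ → P}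
    (hv : IsCocycle v) : IsMultiplicativeOn p Set.univ (edgeValue v) := by
  intro β _ hβ
  have h := hv (p.mkDisk _ hβ)
  have e : ∀ i, v ((p.gajer : SSet.{u}).δ i (p.mkDisk _ hβ)) = edgeValue v (face β i) :=
    fun i => (congrArg v (Perversity.eval_injective rfl)).trans
      (edgeValue_eq v (IsDisk.face_regular hβ i)).symm
  rwa [e, e, e] at h

theorem isCocycle_of_isMultiplicativeOn (hp : p ≤ topPerversity F) (hF : F.IsLocallyFinite)
    {w : C(stdSimplex ℝ (Fin 2), X) → P} (hw : IsMultiplicativeOn p Set.univ w) :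
    IsCocycle fun e : (p.gajer : SSet.{u}) _⦋1⦌ => w (Perversity.eval e) :=
  fun τ => hw (Perversity.eval τ) (fun _ => trivial) (Perversity.isDisk_eval hp hF τ)

/-- The map of Gajer spaces that is given by the inclusion of an open subset. -/
noncomputable abbrev gajerSubtype (p : Perversity F) {V : Opens X}
    (hV : (F.induced V).IsLocallyFinite) :
    ((p.induced V).gajer : SSet.{u}) ⟶ (p.gajer : SSet.{u}) :=
  gajerMap (preservesStrata_subtype p V) hV

/-- The map of Gajer spaces that is given by an inclusion of open subsets. -/
noncomputable abbrev gajerInclusion (p : Perversity F) {V W : Opens X} (h : V ≤ W)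
    (hV : (F.induced V).IsLocallyFinite) :
    ((p.induced V).gajer : SSet.{u}) ⟶ ((p.induced W).gajer : SSet.{u}) :=
  gajerMap (preservesStrata_inclusion p h) hV

theorem induced_le_topPerversity (hp : p ≤ topPerversity F) (V : Opens X) :
    p.induced V ≤ topPerversity (F.induced V) := fun S => hp S.ambient

theorem gajerSubtype_mkRegular (hV : (F.induced V).IsLocallyFinite)
    {α : C(stdSimplex ℝ (Fin 2), X)} (h : ∀ z, α z ∈ V) (hα : ∀ z, α z ∉ F.singularSet) :
    (gajerSubtype p hV).app _ ((p.induced V).mkRegular (restrictTo V α h) hα) =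
      p.mkRegular α hα := Perversity.eval_injective rfl

/-- Cocycles on the members of an open cover that agree on common edges glue. -/
theorem exists_cocycle (hp : p ≤ topPerversity F) (hF : F.IsLocallyFinite)
    (hU : ∀ x, ∃ i, x ∈ U i) (hfin : ∀ i, (F.induced (U i)).IsLocallyFinite)
    {v : ∀ i, ((p.induced (U i)).gajer : SSet.{u}) _⦋1⦌ → P} (hv : ∀ i, IsCocycle (v i))
    (hcomp : ∀ i j e e', (gajerSubtype p (hfin i)).app _ e = (gajerSubtype p (hfin j)).app _ e' →
      v i e = v j e') :
    ∃ W : (p.gajer : SSet.{u}) _⦋1⦌ → P, IsCocycle W ∧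
      ∀ i e, W ((gajerSubtype p (hfin i)).app _ e) = v i e := by
  have hw : ∀ i, IsMultiplicativeOn p (U i : Set X) (edgeValueOn (v i)) :=
    fun i => isMultiplicativeOn_edgeValueOn (hv i)
  have hc : IsCompatible F U fun i => edgeValueOn (v i) := by
    intro i j α hα
    dsimp only
    rw [edgeValueOn_eq _ (fun z => (hα z).1) fun z => (hα z).2.2,
      edgeValueOn_eq _ (fun z => (hα z).2.1) fun z => (hα z).2.2]
    refine hcomp i j _ _ ?_
    rw [gajerSubtype_mkRegular, gajerSubtype_mkRegular]
  refine ⟨_, isCocycle_of_isMultiplicativeOn hp hF (isMultiplicativeOn_glue hU hw hc), ?_⟩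
  intro i e
  have hreg := Perversity.eval_regular_of_le_one (induced_le_topPerversity hp (U i)) le_rfl e
  have hi : ∀ z, Perversity.eval ((gajerSubtype p (hfin i)).app _ e) z ∈ U i :=
    fun z => (Perversity.eval e z).2
  have hreg' : ∀ z, Perversity.eval ((gajerSubtype p (hfin i)).app _ e) z ∉ F.singularSet :=
    fun z => hreg z
  change glue U _ (Perversity.eval ((gajerSubtype p (hfin i)).app _ e)) = _
  rw [glue_eq hU hw hc hreg' hi, edgeValueOn_eq _ hi hreg']
  exact congrArg (v i) (Perversity.eval_injective rfl)

/-- A cocycle is determined by its restrictions to the members of an open cover. -/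
theorem IsCocycle.eq_of_cover (hp : p ≤ topPerversity F)
    (hU : ∀ x, ∃ i, x ∈ U i) (hfin : ∀ i, (F.induced (U i)).IsLocallyFinite)
    {v v' : (p.gajer : SSet.{u}) _⦋1⦌ → P} (hv : IsCocycle v) (hv' : IsCocycle v')
    (h : ∀ i e, v ((gajerSubtype p (hfin i)).app _ e) = v' ((gajerSubtype p (hfin i)).app _ e)) :
    v = v' := by
  funext e
  have hreg := Perversity.eval_regular_of_le_one hp le_rfl e
  have key := (isMultiplicativeOn_edgeValue hv).eq_of_cover hU (isMultiplicativeOn_edgeValue hv')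
    (fun i α hα hi => ?_) hreg
  · rw [edgeValue_eq _ hreg, edgeValue_eq _ hreg] at key
    exact key
  · rw [edgeValue_eq _ hα, edgeValue_eq _ hα, ← gajerSubtype_mkRegular (hfin i) hi hα]
    exact h i _

end

end IntersectionHomotopy

namespace IntersectionHomotopy

open Filtration Simplicial

/-! ### Functors to groups given by paths from a base point -/

namespace FundamentalGroupoid

variable {K L M : SSet.{u}} {P Q : Type u} [Group P] [Group Q]

theorem of_injective : Function.Injective (of (K := K)) := by
  intro a b h
  have h' := FreeGroupoid.of_obj_bijective.1 h
  exact congrArg (fun z => z.as.as) h'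

theorem of_surjective : Function.Surjective (of (K := K)) := by
  intro A
  obtain ⟨B, rfl⟩ := FreeGroupoid.of_obj_bijective.2 A
  obtain ⟨a, rfl⟩ := SSet.Truncated.HomotopyCategory.mk_surjective B
  exact ⟨a, rfl⟩

theorem map_map (f : K ⟶ L) (g : L ⟶ M) {A B : FundamentalGroupoid K} (m : A ⟶ B) :
    (map g).map ((map f).map m) = (map (f ≫ g)).map m :=
  ((Functor.congr_hom (map_comp_functor f g) m).trans
    ((Category.id_comp _).trans (Category.comp_id _))).symm

/-- The functor to a group that is given by a homomorphism from the vertex group and a choice of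
morphisms from the base point. -/
def conj {b : FundamentalGroupoid K} (d : ∀ A, b ⟶ A) (f : (b ⟶ b) →* P) :
    FundamentalGroupoid K ⥤ SingleObj Pᵐᵒᵖ where
  obj _ := SingleObj.star _
  map {A B} m := MulOpposite.op (f (d A ≫ m ≫ Groupoid.inv (d B)))
  map_id A := by
    rw [Category.id_comp, Groupoid.comp_inv]
    exact congrArg MulOpposite.op f.map_one
  map_comp {A B C} m m' := by
    have h : d A ≫ (m ≫ m') ≫ Groupoid.inv (d C) =
        (d A ≫ m ≫ Groupoid.inv (d B)) * (d B ≫ m' ≫ Groupoid.inv (d C)) := by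
      simp [Groupoid.vertexGroup_mul]
    rw [h, map_mul]
    rfl

theorem value_conj {b : FundamentalGroupoid K} (d : ∀ A, b ⟶ A) (f : (b ⟶ b) →* P)
    {A B : FundamentalGroupoid K} (m : A ⟶ B) :
    value (conj d f) m = f (d A ≫ m ≫ Groupoid.inv (d B)) := rfl

theorem value_conj_of_eq_id {b : FundamentalGroupoid K} {d : ∀ A, b ⟶ A} (hd : d b = 𝟙 b)
    (f : (b ⟶ b) →* P) (m : b ⟶ b) : value (conj d f) m = f m := by
  rw [value_conj, hd]
  simp

/-- As the chosen morphisms correspond under `g`, restricting `conj` along `g` only restricts the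
homomorphism. This makes functors over different open sets comparable. -/
theorem value_conj_map (g : K ⟶ L) {b : FundamentalGroupoid K} {d : ∀ A, b ⟶ A}
    {d' : ∀ A, (map g).obj b ⟶ A} (hd : ∀ A, d' ((map g).obj A) = (map g).map (d A))
    (f : ((map g).obj b ⟶ (map g).obj b) →* P) {A B : FundamentalGroupoid K} (m : A ⟶ B) :
    value (conj d' f) ((map g).map m) = f ((map g).map (d A ≫ m ≫ Groupoid.inv (d B))) := by
  rw [value_conj, hd, hd]
  simp

theorem cocycle_app (g : K ⟶ L) (V : FundamentalGroupoid L ⥤ SingleObj Pᵐᵒᵖ) (e : K _⦋1⦌) :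
    cocycle V (g.app _ e) = value V ((map g).map (ofEdge (SSet.Edge.mk' e))) :=
  cocycle_edge V ((SSet.Edge.mk' e).map g)

/-- The composition of a functor to a group with a homomorphism. -/
def mapValue (V : FundamentalGroupoid K ⥤ SingleObj Pᵐᵒᵖ) (f : P →* Q) :
    FundamentalGroupoid K ⥤ SingleObj Qᵐᵒᵖ where
  obj _ := SingleObj.star _
  map m := MulOpposite.op (f (value V m))
  map_id A := by
    rw [value_id]
    exact congrArg MulOpposite.op f.map_one
  map_comp m m' := by
    rw [value_comp, map_mul]
    rfl

theorem value_mapValue (V : FundamentalGroupoid K ⥤ SingleObj Pᵐᵒᵖ) (f : P →* Q)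
    {A B : FundamentalGroupoid K} (m : A ⟶ B) : value (mapValue V f) m = f (value V m) := rfl

/-- The homomorphism on a vertex group that is given by a functor to a group. -/
def valueHom (V : FundamentalGroupoid K ⥤ SingleObj Pᵐᵒᵖ) (b : FundamentalGroupoid K) :
    (b ⟶ b) →* P where
  toFun m := value V m
  map_one' := value_id V b
  map_mul' m m' := value_comp V m m'

theorem exists_hom_from [K.IsConnected] (b : FundamentalGroupoid K) :
    ∃ d : ∀ A, b ⟶ A, d b = 𝟙 b := by
  have h : ∀ A, Nonempty (b ⟶ A) := by
    intro A
    obtain ⟨a, rfl⟩ := of_surjective A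
    obtain ⟨b, rfl⟩ := of_surjective b
    exact nonempty_hom b a
  refine ⟨fun A => Groupoid.inv (h b).some ≫ (h A).some, ?_⟩
  simp

end FundamentalGroupoid

theorem Pi1.map_apply {K L : SSet.{u}} (f : K ⟶ L) {x : K _⦋0⦌} (m : Pi1 K x) :
    Pi1.map f rfl m = (FundamentalGroupoid.map f).map m := by
  have h : Pi1.map f rfl m = Groupoid.inv (𝟙 (FundamentalGroupoid.of (f.app _ x))) ≫
      (FundamentalGroupoid.map f).map m ≫ 𝟙 (FundamentalGroupoid.of (f.app _ x)) := rfl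
  rw [h, Groupoid.inv_eq_inv, IsIso.inv_id]
  exact (Category.id_comp _).trans (Category.comp_id _)

/-! ### Choices of morphisms from the base point, compatible with inclusions -/

section

open IntersectionHomotopy.FundamentalGroupoid

variable {X : Type u} [TopologicalSpace X] {n : ℕ} {F : Filtration X n} {p : Perversity F}

/-- Below the top perversity every vertex of the Gajer space is a regular point. -/
theorem exists_eq_of_vertex (hp : p ≤ topPerversity F)
    (A : FundamentalGroupoid (p.gajer : SSet.{u})) :
    ∃ x hx, A = FundamentalGroupoid.of (p.vertex x hx) := by
  obtain ⟨a, rfl⟩ := of_surjective A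
  have hx := Perversity.eval_regular_of_le_one hp zero_le_one a default
  refine ⟨Perversity.eval a default, hx, congrArg of (Perversity.eval_injective ?_)⟩
  ext z
  exact congrArg _ (Subsingleton.elim (α := stdSimplex ℝ (Fin 1)) _ _)

theorem of_vertex_injective {x y : X} {hx : x ∉ F.singularSet} {hy : y ∉ F.singularSet}
    (h : FundamentalGroupoid.of (p.vertex x hx) = FundamentalGroupoid.of (p.vertex y hy)) :
    x = y := by
  have h' := congrArg Perversity.eval (of_injective h)
  exact congrArg (fun f => f (default : stdSimplex ℝ (Fin 1))) h'

/-- Objects correspond bijectively to regular points, so a choice of morphisms may be prescribed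
pointwise; `eqToHom` transports it along the identification of objects. -/
theorem exists_extension (hp : p ≤ topPerversity F) {b : FundamentalGroupoid (p.gajer : SSet.{u})}
    (c : ∀ x hx, b ⟶ FundamentalGroupoid.of (p.vertex x hx)) :
    ∃ d : ∀ A, b ⟶ A, ∀ x hx, d (FundamentalGroupoid.of (p.vertex x hx)) = c x hx := by
  choose y hy e using exists_eq_of_vertex hp
  refine ⟨fun A => c (y A) (hy A) ≫ eqToHom (e A).symm, fun x hx => ?_⟩
  have key : ∀ (y : X) (hy : y ∉ F.singularSet)
      (e : FundamentalGroupoid.of (p.vertex x hx) = FundamentalGroupoid.of (p.vertex y hy)),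
      y = x → c y hy ≫ eqToHom e.symm = c x hx := by
    rintro y hy e rfl
    rw [eqToHom_refl, Category.comp_id]
  exact key _ _ (e _) (of_vertex_injective (e _)).symm

/-- Over points of `V` the choice is the image of `d`; over the other points any morphism will do,
by connectedness of `W`. -/
theorem exists_extension_inclusion (hp : p ≤ topPerversity F) {V W : Opens X} (h : V ≤ W)
    (hV : (F.induced V).IsLocallyFinite) [hW : ((p.induced W).gajer : SSet.{u}).IsConnected]
    {b : FundamentalGroupoid ((p.induced V).gajer : SSet.{u})} (d : ∀ A, b ⟶ A) :
    ∃ d' : ∀ A, (FundamentalGroupoid.map (gajerInclusion p h hV)).obj b ⟶ A,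
      ∀ A, d' ((FundamentalGroupoid.map (gajerInclusion p h hV)).obj A) =
        (FundamentalGroupoid.map (gajerInclusion p h hV)).map (d A) := by
  classical
  obtain ⟨d₀, -⟩ := exists_hom_from ((FundamentalGroupoid.map (gajerInclusion p h hV)).obj b)
  obtain ⟨d', hd'⟩ := exists_extension (induced_le_topPerversity hp W)
    (b := (FundamentalGroupoid.map (gajerInclusion p h hV)).obj b)
    (fun x hx => if hxV : (x : X) ∈ V then
      (FundamentalGroupoid.map (gajerInclusion p h hV)).map
        (d (FundamentalGroupoid.of ((p.induced V).vertex ⟨x, hxV⟩ hx))) else d₀ _)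
  refine ⟨d', fun A => ?_⟩
  obtain ⟨x, hx, rfl⟩ := exists_eq_of_vertex (induced_le_topPerversity hp V) A
  exact (hd' ⟨x, h x.2⟩ hx).trans (dif_pos x.2)

theorem iota_apply {U : Opens X} (hU : (F.induced U).IsLocallyFinite) {x : X} (hxU : x ∈ U)
    (hx : x ∉ F.singularSet) (m : p.pi1On U hxU hx) :
    p.iota hU hxU hx m = (FundamentalGroupoid.map (gajerSubtype p hU)).map m :=
  Pi1.map_apply _ _

theorem incl_apply {U V : Opens X} (h : U ≤ V) (hU : (F.induced U).IsLocallyFinite) {x : X}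
    (hxU : x ∈ U) (hx : x ∉ F.singularSet) (m : p.pi1On U hxU hx) :
    p.incl h hU hxU hx m = (FundamentalGroupoid.map (gajerInclusion p h hU)).map m :=
  Pi1.map_apply _ _

theorem iota_incl {U V : Opens X} (h : U ≤ V) (hU : (F.induced U).IsLocallyFinite)
    (hV : (F.induced V).IsLocallyFinite) {x : X} (hxU : x ∈ U) (hx : x ∉ F.singularSet)
    (m : p.pi1On U hxU hx) :
    p.iota hV (h hxU) hx (p.incl h hU hxU hx m) = p.iota hU hxU hx m := by
  rw [iota_apply, iota_apply, incl_apply]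
  exact map_map (gajerInclusion p h hU) (gajerSubtype p hV) m

end

end IntersectionHomotopy

namespace IntersectionHomotopy

open Filtration Simplicial

/-! ### Gluing functors to a group over a cover by two open sets -/

section

open IntersectionHomotopy.FundamentalGroupoid

variable {X : Type u} [TopologicalSpace X] {n : ℕ} {F : Filtration X n} {p : Perversity F}

theorem exists_extension_subtype (hp : p ≤ topPerversity F) {U₀ U₁ : Opens X}
    (hcover : U₀ ⊔ U₁ = ⊤) (hfin₀ : (F.induced U₀).IsLocallyFinite)
    (hfin₁ : (F.induced U₁).IsLocallyFinite) (hfin : (F.induced (U₀ ⊓ U₁)).IsLocallyFinite)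
    {x₀ : X} (hx₀ : x₀ ∈ U₀ ⊓ U₁) (hreg : x₀ ∉ F.singularSet)
    {d : ∀ A, of ((p.induced (U₀ ⊓ U₁)).vertex ⟨x₀, hx₀⟩ hreg) ⟶ A}
    {d₀ : ∀ A, of ((p.induced U₀).vertex ⟨x₀, hx₀.1⟩ hreg) ⟶ A}
    {d₁ : ∀ A, of ((p.induced U₁).vertex ⟨x₀, hx₀.2⟩ hreg) ⟶ A}
    (hd₀ : ∀ A, d₀ ((FundamentalGroupoid.map (gajerInclusion p inf_le_left hfin)).obj A) =
      (FundamentalGroupoid.map (gajerInclusion p inf_le_left hfin)).map (d A))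
    (hd₁ : ∀ A, d₁ ((FundamentalGroupoid.map (gajerInclusion p inf_le_right hfin)).obj A) =
      (FundamentalGroupoid.map (gajerInclusion p inf_le_right hfin)).map (d A)) :
    ∃ c : ∀ A, of (p.vertex x₀ hreg) ⟶ A,
      (∀ A, c ((FundamentalGroupoid.map (gajerSubtype p hfin₀)).obj A) =
        (FundamentalGroupoid.map (gajerSubtype p hfin₀)).map (d₀ A)) ∧
      ∀ A, c ((FundamentalGroupoid.map (gajerSubtype p hfin₁)).obj A) =
        (FundamentalGroupoid.map (gajerSubtype p hfin₁)).map (d₁ A) := by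
  classical
  have hx : ∀ x, x ∉ U₀ → x ∈ U₁ := fun x h => by
    have hx : x ∈ U₀ ⊔ U₁ := by rw [hcover]; trivial
    exact hx.resolve_left h
  obtain ⟨c, hc⟩ := exists_extension hp (b := of (p.vertex x₀ hreg)) (fun x hxr =>
    if h : x ∈ U₀ then
      (FundamentalGroupoid.map (gajerSubtype p hfin₀)).map
        (d₀ (of ((p.induced U₀).vertex ⟨x, h⟩ hxr)))
    else (FundamentalGroupoid.map (gajerSubtype p hfin₁)).map
        (d₁ (of ((p.induced U₁).vertex ⟨x, hx x h⟩ hxr))))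
  refine ⟨c, fun A => ?_, fun A => ?_⟩
  · obtain ⟨x, hxr, rfl⟩ := exists_eq_of_vertex (induced_le_topPerversity hp U₀) A
    exact (hc x hxr).trans (dif_pos x.2)
  · obtain ⟨x, hxr, rfl⟩ := exists_eq_of_vertex (induced_le_topPerversity hp U₁) A
    -- Over the intersection the images of `d₀` and `d₁` agree, as both are images of `d`, so the
    -- preference for `U₀` in the definition of `c` does no harm.
    by_cases h : (x : X) ∈ U₀
    · refine (hc x hxr).trans ((dif_pos h).trans ?_)
      have e₀ := hd₀ (of ((p.induced (U₀ ⊓ U₁)).vertex ⟨x, h, x.2⟩ hxr))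
      have e₁ := hd₁ (of ((p.induced (U₀ ⊓ U₁)).vertex ⟨x, h, x.2⟩ hxr))
      refine (congrArg (FundamentalGroupoid.map (gajerSubtype p hfin₀)).map e₀).trans
        (Eq.trans ?_ (congrArg (FundamentalGroupoid.map (gajerSubtype p hfin₁)).map e₁).symm)
      exact (map_map (gajerInclusion p inf_le_left hfin) (gajerSubtype p hfin₀) _).trans
        (map_map (gajerInclusion p inf_le_right hfin) (gajerSubtype p hfin₁) _).symm
    · exact (hc x hxr).trans (dif_neg h)

/-- Functors to a group on the fundamental groupoids of the members of a cover by two open subsets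
that agree on the intersection extend to the fundamental groupoid of the space. -/
theorem exists_functor_of_cover {P : Type u} [Group P] (hp : p ≤ topPerversity F)
    {U₀ U₁ : Opens X} (hcover : U₀ ⊔ U₁ = ⊤) (hfin₀ : (F.induced U₀).IsLocallyFinite)
    (hfin₁ : (F.induced U₁).IsLocallyFinite) (hfin : (F.induced (U₀ ⊓ U₁)).IsLocallyFinite)
    (V₀ : FundamentalGroupoid ((p.induced U₀).gajer : SSet.{u}) ⥤ SingleObj Pᵐᵒᵖ)
    (V₁ : FundamentalGroupoid ((p.induced U₁).gajer : SSet.{u}) ⥤ SingleObj Pᵐᵒᵖ)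
    (h : ∀ (A B : FundamentalGroupoid ((p.induced (U₀ ⊓ U₁)).gajer : SSet.{u})) (m : A ⟶ B),
      value V₀ ((FundamentalGroupoid.map (gajerInclusion p inf_le_left hfin)).map m) =
        value V₁ ((FundamentalGroupoid.map (gajerInclusion p inf_le_right hfin)).map m)) :
    ∃ V : FundamentalGroupoid (p.gajer : SSet.{u}) ⥤ SingleObj Pᵐᵒᵖ,
      FundamentalGroupoid.map (gajerSubtype p hfin₀) ⋙ V = V₀ ∧
      FundamentalGroupoid.map (gajerSubtype p hfin₁) ⋙ V = V₁ := by
  have hcomp : ∀ (e : ((p.induced U₀).gajer : SSet.{u}) _⦋1⦌)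
      (e' : ((p.induced U₁).gajer : SSet.{u}) _⦋1⦌),
      (gajerSubtype p hfin₀).app _ e = (gajerSubtype p hfin₁).app _ e' →
      cocycle V₀ e = cocycle V₁ e' := by
    intro e e' hee
    have hreg := Perversity.eval_regular_of_le_one (induced_le_topPerversity hp U₀) le_rfl e
    have hev : ∀ z, (Perversity.eval e z : X) = Perversity.eval e' z :=
      fun z => congrArg (fun f => Perversity.eval f z) hee
    let α : C(stdSimplex ℝ (Fin 2), X) := ⟨fun z => Perversity.eval e z,
      continuous_subtype_val.comp (Perversity.eval e).continuous⟩
    have hα : ∀ z, α z ∈ U₀ ⊓ U₁ := fun z => ⟨(Perversity.eval e z).2, by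
      change (Perversity.eval e z : X) ∈ U₁
      rw [hev]
      exact (Perversity.eval e' z).2⟩
    -- An edge common to both Gajer spaces is regular with image in the intersection, so it is an
    -- edge there, where `h` compares the two functors.
    let ε := (p.induced (U₀ ⊓ U₁)).mkRegular (restrictTo _ α hα) hreg
    have h₀ : (gajerInclusion p inf_le_left hfin).app _ ε = e := Perversity.eval_injective rfl
    have h₁ : (gajerInclusion p inf_le_right hfin).app _ ε = e' := by
      refine Perversity.eval_injective ?_
      ext z
      exact hev z
    rw [← h₀, ← h₁, cocycle_app, cocycle_app]
    exact h _ _ _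
  let U : Bool → Opens X := fun b => match b with
    | false => U₀
    | true => U₁
  have hU : ∀ x, ∃ b, x ∈ U b := by
    intro x
    have hx : x ∈ U₀ ⊔ U₁ := by rw [hcover]; trivial
    exact hx.elim (fun h => ⟨false, h⟩) fun h => ⟨true, h⟩
  have hfinU : ∀ b, (F.induced (U b)).IsLocallyFinite := fun b => match b with
    | false => hfin₀
    | true => hfin₁
  obtain ⟨W, hW, hWv⟩ := exists_cocycle (P := P) hp (isLocallyFinite_of_cover hcover hfin₀ hfin₁) hU
    hfinU (v := fun b => match b with
      | false => cocycle V₀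
      | true => cocycle V₁)
    (fun b => match b with
      | false => isCocycle_cocycle V₀
      | true => isCocycle_cocycle V₁)
    -- For equal indices the condition only says that the inclusion is injective on edges.
    (fun b b' => match b, b' with
      | false, false => fun e e' h => congrArg (cocycle V₀) (Perversity.eval_injective
          (by ext z; exact congrArg (fun f => Perversity.eval f z) h))
      | false, true => hcomp
      | true, false => fun e e' h => (hcomp e' e h.symm).symm
      | true, true => fun e e' h => congrArg (cocycle V₁) (Perversity.eval_injective
          (by ext z; exact congrArg (fun f => Perversity.eval f z) h)))
  obtain ⟨V, rfl⟩ := exists_functor hW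
  refine ⟨V, functor_ext (funext fun e => ?_), functor_ext (funext fun e => ?_)⟩
  · exact (cocycle_app (gajerSubtype p hfin₀) V e).symm.trans (hWv false e)
  · exact (cocycle_app (gajerSubtype p hfin₁) V e).symm.trans (hWv true e)

/-- A functor to a group is determined by its restrictions to the members of an open cover. -/
theorem functor_eq_of_cover {P : Type u} [Group P] (hp : p ≤ topPerversity F)
    {U₀ U₁ : Opens X} (hcover : U₀ ⊔ U₁ = ⊤) (hfin₀ : (F.induced U₀).IsLocallyFinite)
    (hfin₁ : (F.induced U₁).IsLocallyFinite)
    {V V' : FundamentalGroupoid (p.gajer : SSet.{u}) ⥤ SingleObj Pᵐᵒᵖ}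
    (h₀ : ∀ A B (m : A ⟶ B), value V ((FundamentalGroupoid.map (gajerSubtype p hfin₀)).map m) =
      value V' ((FundamentalGroupoid.map (gajerSubtype p hfin₀)).map m))
    (h₁ : ∀ A B (m : A ⟶ B), value V ((FundamentalGroupoid.map (gajerSubtype p hfin₁)).map m) =
      value V' ((FundamentalGroupoid.map (gajerSubtype p hfin₁)).map m)) : V = V' := by
  let U : Bool → Opens X := fun b => match b with
    | false => U₀
    | true => U₁
  have hU : ∀ x, ∃ b, x ∈ U b := by
    intro x
    have hx : x ∈ U₀ ⊔ U₁ := by rw [hcover]; trivial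
    exact hx.elim (fun h => ⟨false, h⟩) fun h => ⟨true, h⟩
  have hfinU : ∀ b, (F.induced (U b)).IsLocallyFinite := fun b => match b with
    | false => hfin₀
    | true => hfin₁
  refine functor_ext ((isCocycle_cocycle V).eq_of_cover hp hU hfinU (isCocycle_cocycle V') ?_)
  intro b e
  rw [cocycle_app, cocycle_app]
  match b with
  | false => exact h₀ _ _ _
  | true => exact h₁ _ _ _

end

end IntersectionHomotopy

/-! ### The Van Kampen theorem -/

open IntersectionHomotopy TopologicalSpace in
theorem theorem3 {X : Type u} [TopologicalSpace X] {n : ℕ} (F : Filtration X n)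
    (p : Perversity F) (hp : p ≤ topPerversity F)
    (U₀ U₁ : Opens X) (hcover : U₀ ⊔ U₁ = ⊤)
    (hfin₀ : (F.induced U₀).IsLocallyFinite) (hfin₁ : (F.induced U₁).IsLocallyFinite)
    (hfin : (F.induced (U₀ ⊓ U₁)).IsLocallyFinite)
    (hconn₀ : (p.induced U₀).IsConnected) (hconn₁ : (p.induced U₁).IsConnected)
    (hconn : (p.induced (U₀ ⊓ U₁)).IsConnected)
    (x₀ : X) (hx₀ : x₀ ∈ U₀ ⊓ U₁) (hreg : x₀ ∉ F.singularSet) :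
    let j₀ : p.pi1On (U₀ ⊓ U₁) hx₀ hreg →* p.pi1On U₀ hx₀.1 hreg :=
      p.incl inf_le_left hfin hx₀ hreg
    let j₁ : p.pi1On (U₀ ⊓ U₁) hx₀ hreg →* p.pi1On U₁ hx₀.2 hreg :=
      p.incl inf_le_right hfin hx₀ hreg
    let Φ : Monoid.Coprod (p.pi1On U₀ hx₀.1 hreg) (p.pi1On U₁ hx₀.2 hreg) →* p.pi1 x₀ hreg :=
      Monoid.Coprod.lift (p.iota hfin₀ hx₀.1 hreg) (p.iota hfin₁ hx₀.2 hreg)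
    Function.Surjective Φ ∧
      Φ.ker = Subgroup.normalClosure
        (Set.range fun ω => Monoid.Coprod.inl (j₀ ω) * (Monoid.Coprod.inr (j₁ ω))⁻¹) := by
  intro j₀ j₁ Φ
  set N := Subgroup.normalClosure
    (Set.range fun ω => Monoid.Coprod.inl (j₀ ω) * (Monoid.Coprod.inr (j₁ ω))⁻¹) with hN
  have hNker : N ≤ Φ.ker := by
    refine Subgroup.normalClosure_le_normal ?_
    rintro _ ⟨ω, rfl⟩
    change Φ _ = 1
    rw [map_mul, map_inv, mul_inv_eq_one]
    simp only [Φ, Monoid.Coprod.lift_apply_inl, Monoid.Coprod.lift_apply_inr, j₀, j₁]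
    exact (iota_incl inf_le_left hfin hfin₀ hx₀ hreg ω).trans
      (iota_incl inf_le_right hfin hfin₁ hx₀ hreg ω).symm
  -- The target group is the free product modulo `N`, in which the two images of a loop in the
  -- intersection agree.
  let f₀ : p.pi1On U₀ hx₀.1 hreg →* _ := (QuotientGroup.mk' N).comp Monoid.Coprod.inl
  let f₁ : p.pi1On U₁ hx₀.2 hreg →* _ := (QuotientGroup.mk' N).comp Monoid.Coprod.inr
  have hf : ∀ ω, f₀ (j₀ ω) = f₁ (j₁ ω) := fun ω =>
    (QuotientGroup.eq_iff_div_mem).2 (by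
      rw [div_eq_mul_inv]
      exact Subgroup.subset_normalClosure ⟨ω, rfl⟩)
  have := hconn₀
  have := hconn₁
  have := hconn
  unfold Perversity.IsConnected at *
  obtain ⟨d, hd⟩ := FundamentalGroupoid.exists_hom_from
    (FundamentalGroupoid.of ((p.induced (U₀ ⊓ U₁)).vertex ⟨x₀, hx₀⟩ hreg))
  obtain ⟨d₀, hd₀⟩ := exists_extension_inclusion hp inf_le_left hfin (W := U₀) d
  obtain ⟨d₁, hd₁⟩ := exists_extension_inclusion hp inf_le_right hfin (W := U₁) d
  obtain ⟨c, hc₀, hc₁⟩ := exists_extension_subtype hp hcover hfin₀ hfin₁ hfin hx₀ hreg hd₀ hd₁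
  -- The chosen morphism at the base point is the identity, so `conj` restricts on the vertex group
  -- to the given homomorphism.
  have hd₀' : d₀ (FundamentalGroupoid.of ((p.induced U₀).vertex ⟨x₀, hx₀.1⟩ hreg)) = 𝟙 _ :=
    (hd₀ _).trans ((congrArg _ hd).trans (CategoryTheory.Functor.map_id _ _))
  have hd₁' : d₁ (FundamentalGroupoid.of ((p.induced U₁).vertex ⟨x₀, hx₀.2⟩ hreg)) = 𝟙 _ :=
    (hd₁ _).trans ((congrArg _ hd).trans (CategoryTheory.Functor.map_id _ _))
  have hc' : c (FundamentalGroupoid.of (p.vertex x₀ hreg)) = 𝟙 _ :=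
    (hc₀ _).trans ((congrArg _ hd₀').trans (CategoryTheory.Functor.map_id _ _))
  obtain ⟨Ψ, hΨ₀, hΨ₁⟩ := exists_functor_of_cover hp hcover hfin₀ hfin₁ hfin
    (FundamentalGroupoid.conj d₀ f₀) (FundamentalGroupoid.conj d₁ f₁) (by
      intro A B m
      refine (FundamentalGroupoid.value_conj_map _ hd₀ f₀ m).trans
        (Eq.trans ?_ (FundamentalGroupoid.value_conj_map _ hd₁ f₁ m).symm)
      have h := hf (d A ≫ m ≫ Groupoid.inv (d B))
      simp only [j₀, j₁] at h
      rw [incl_apply, incl_apply] at h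
      exact h)
  have hval₀ : ∀ (A B : IntersectionHomotopy.FundamentalGroupoid
      ((p.induced U₀).gajer : SSet.{u})) (m : A ⟶ B), FundamentalGroupoid.value Ψ
      ((IntersectionHomotopy.FundamentalGroupoid.map (gajerSubtype p hfin₀)).map m) =
      FundamentalGroupoid.value (FundamentalGroupoid.conj d₀ f₀) m := by
    intro A B m
    rw [← hΨ₀]
    rfl
  have hval₁ : ∀ (A B : IntersectionHomotopy.FundamentalGroupoid
      ((p.induced U₁).gajer : SSet.{u})) (m : A ⟶ B), FundamentalGroupoid.value Ψ
      ((IntersectionHomotopy.FundamentalGroupoid.map (gajerSubtype p hfin₁)).map m) =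
      FundamentalGroupoid.value (FundamentalGroupoid.conj d₁ f₁) m := by
    intro A B m
    rw [← hΨ₁]
    rfl
  have hΦ₀ : ∀ m : p.pi1On U₀ hx₀.1 hreg, Φ (Monoid.Coprod.inl m) =
      (IntersectionHomotopy.FundamentalGroupoid.map (gajerSubtype p hfin₀)).map m :=
    fun m => (Monoid.Coprod.lift_apply_inl _ _ _).trans (iota_apply hfin₀ hx₀.1 hreg m)
  have hΦ₁ : ∀ m : p.pi1On U₁ hx₀.2 hreg, Φ (Monoid.Coprod.inr m) =
      (IntersectionHomotopy.FundamentalGroupoid.map (gajerSubtype p hfin₁)).map m :=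
    fun m => (Monoid.Coprod.lift_apply_inr _ _ _).trans (iota_apply hfin₁ hx₀.2 hreg m)
  let ψ := FundamentalGroupoid.valueHom Ψ (FundamentalGroupoid.of (p.vertex x₀ hreg))
  have hψ : ψ.comp Φ = QuotientGroup.mk' N := by
    refine Monoid.Coprod.hom_ext ?_ ?_
    · ext m
      refine (congrArg ψ (hΦ₀ m)).trans ((hval₀ _ _ m).trans ?_)
      exact FundamentalGroupoid.value_conj_of_eq_id hd₀' f₀ m
    · ext m
      refine (congrArg ψ (hΦ₁ m)).trans ((hval₁ _ _ m).trans ?_)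
      exact FundamentalGroupoid.value_conj_of_eq_id hd₁' f₁ m
  refine ⟨fun m => ?_, le_antisymm (fun a ha => ?_) hNker⟩
  · let Φ' := QuotientGroup.lift N Φ hNker
    let f : p.pi1 x₀ hreg →* p.pi1 x₀ hreg := MonoidHom.id _
    -- On a loop `m` at the base point the left side has value `m`, and the right side has value
    -- `Φ'` of a class in the quotient; any representative of that class is a preimage of `m`.
    have hT : FundamentalGroupoid.conj c f = FundamentalGroupoid.mapValue Ψ Φ' := by
      refine functor_eq_of_cover hp hcover hfin₀ hfin₁ (fun A B m => ?_) fun A B m => ?_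
      · have h := FundamentalGroupoid.value_conj_map (gajerSubtype p hfin₀)
          (b := FundamentalGroupoid.of ((p.induced U₀).vertex ⟨x₀, hx₀.1⟩ hreg)) hc₀ f m
        refine h.trans ?_
        rw [FundamentalGroupoid.value_mapValue, hval₀]
        exact (hΦ₀ _).symm
      · have h := FundamentalGroupoid.value_conj_map (gajerSubtype p hfin₁)
          (b := FundamentalGroupoid.of ((p.induced U₁).vertex ⟨x₀, hx₀.2⟩ hreg)) hc₁ f m
        refine h.trans ?_
        rw [FundamentalGroupoid.value_mapValue, hval₁]
        exact (hΦ₁ _).symm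
    have h := FundamentalGroupoid.value_conj_of_eq_id hc' f m
    rw [hT, FundamentalGroupoid.value_mapValue] at h
    obtain ⟨a, ha⟩ := QuotientGroup.mk'_surjective N (FundamentalGroupoid.value Ψ m)
    rw [← ha] at h
    exact ⟨a, h⟩
  -- Since `ψ` undoes `Φ` modulo `N`, an element of the kernel of `Φ` is trivial in the quotient.
  · have h := DFunLike.congr_fun hψ a
    rw [MonoidHom.comp_apply, MonoidHom.mem_ker.1 ha, map_one] at h
    exact (QuotientGroup.eq_one_iff a).1 h.symm
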